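/- Everything is a $C^\infty$ germ at the origin of $\mathbb{R}^2$. Let $\mathcal{E}$ be the ring of germs at $0$ of smooth real functions, $a_L=x\,dy$ the Liouville form and $X_{a_L}=-x\,\frac{\partial}{\partial x}$ its vector field. For germs of vector fields write $X_1\sim X_2$ (orbital $a_L$-conjugacy) if there are a germ of a diffeomorphism $\phi:(\mathbb{R}^2,0)\to(\mathbb{R}^2,0)$ and germs $k,h\in\mathcal{E}$ with $k(0)\neq 0$, $h(0)\neq0$, such that $a_L=k\cdot\phi^*a_L$ and $X_1=h\cdot\phi^*X_2$. The codimension of $f\in\mathcal{E}$, and of the vector field $f\cdot X_{a_L}$, is $$\operatorname{codim}(f)=\operatorname{codim}(f\cdot X_{a_L})=\dim_{\mathbb{R}}\big(\mathcal{E}/\langle f,\mathcal{L}_{X_{a_L}}f\rangle\big),$$ where $\langle\cdot,\cdot\rangle$ is the generated ideal and $\mathcal{L}$ the Lie derivative; $j^kf$ denotes the Taylor polynomial of $f$ of degree $k$ at the origin. Let $f\in\mathcal{E}$ and $X=f\cdot X_{a_L}$. 1. If $f(0)\neq 0$, then $X\sim X_{a_L}$. Every vector field $Y\sim X_{a_L}$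 is a multiple of $X_{a_L}$ of codimension $0$. 2. If $f(0)=0$, $d_0f\neq0$, and the curve $\{f=0\}$ is transversal at the origin to both coordinate axes, then $X\sim(x+y)\cdot X_{a_L}$. The class of $(x+y)\cdot X_{a_L}$ is the unique class of codimension $1$: a germ of a vector field $Y$ satisfies $Y\sim(x+y)\cdot X_{a_L}$ if and only if $Y=g\cdot X_{a_L}$ for some $g\in\mathcal{E}$ of codimension $1$. 3. If $f(0)=0$ and $f$ has finite codimension $k$, then $X\sim j^kf\cdot X_{a_L}$. -/

import Mathlib

open Filter Topology
open scoped ContDiff Manifold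

/-- The plane; everything below is local at its origin. -/
abbrev Plane : Type := ℝ × ℝ

/-- `f` is `C^∞` on a neighbourhood of the origin (one neighbourhood for all orders), i.e. `f`
represents a smooth germ at the origin. -/
def SmoothNear {F : Type*} [NormedAddCommGroup F] [NormedSpace ℝ F] (f : Plane → F) : Prop :=
  ∀ᶠ p in 𝓝 (0 : Plane), ContDiffAt ℝ ∞ f p

/-- The real algebra of functions that are smooth near the origin. -/
def smoothNearFunctions : Subalgebra ℝ (Plane → ℝ) where
  carrier := {f | SmoothNear f}
  mul_mem' := by
    intro f g hf hg
    filter_upwards [hf, hg] with p h1 h2 using h1.mul h2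
  add_mem' := by
    intro f g hf hg
    filter_upwards [hf, hg] with p h1 h2 using h1.add h2
  algebraMap_mem' := by
    intro r
    exact Eventually.of_forall fun p => contDiffAt_const

/-- The ideal of functions that vanish on a neighbourhood of the origin. -/
def vanishingNear : Ideal smoothNearFunctions where
  carrier := {f | (f : Plane → ℝ) =ᶠ[𝓝 0] 0}
  add_mem' := by
    intro f g hf hg
    have hf' : (f : Plane → ℝ) =ᶠ[𝓝 0] 0 := hf
    have hg' : (g : Plane → ℝ) =ᶠ[𝓝 0] 0 := hg
    change ((f : Plane → ℝ) + (g : Plane → ℝ)) =ᶠ[𝓝 0] 0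
    filter_upwards [hf', hg'] with p h1 h2
    simp [h1, h2]
  zero_mem' := EventuallyEq.refl _ _
  smul_mem' := by
    intro c f hf
    have hf' : (f : Plane → ℝ) =ᶠ[𝓝 0] 0 := hf
    change ((c : Plane → ℝ) * (f : Plane → ℝ)) =ᶠ[𝓝 0] 0
    filter_upwards [hf'] with p h1
    simp [h1]

/-- The ring `ℰ` of germs at the origin of smooth functions. -/
def FunctionGerm : Type := smoothNearFunctions ⧸ vanishingNear

noncomputable instance : CommRing FunctionGerm :=
  inferInstanceAs (CommRing (smoothNearFunctions ⧸ vanishingNear))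

noncomputable instance : Algebra ℝ FunctionGerm :=
  inferInstanceAs (Algebra ℝ (smoothNearFunctions ⧸ vanishingNear))

/-- The germ at the origin of a function that is smooth near the origin. -/
noncomputable def functionGerm (f : Plane → ℝ) (hf : SmoothNear f) : FunctionGerm :=
  Ideal.Quotient.mk vanishingNear ⟨f, hf⟩

/-- The Lie derivative of the function `f` along the vector field `X`. -/
noncomputable def lieDerivative (X : Plane → Plane) (f : Plane → ℝ) : Plane → ℝ :=
  fun p => fderiv ℝ f p (X p)

theorem SmoothNear.lieDerivative {X : Plane → Plane} {f : Plane → ℝ}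
    (hX : SmoothNear X) (hf : SmoothNear f) : SmoothNear (lieDerivative X f) := by
  filter_upwards [hX, hf] with p h1 h2
  exact (h2.fderiv_right (m := ∞) (by simp)).clm_apply h1

/-- The tangent space `⟨f, L_X f⟩` (an ideal of `ℰ`) at `f` of the class of `f`. -/
noncomputable def tangentIdeal (X : Plane → Plane) (hX : SmoothNear X)
    (f : Plane → ℝ) (hf : SmoothNear f) : Ideal FunctionGerm :=
  Ideal.span {functionGerm f hf, functionGerm (lieDerivative X f) (hX.lieDerivative hf)}

/-- The codimension of `f` relative to the vector field `X`: the real dimension of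
`ℰ ⧸ ⟨f, L_X f⟩`, as a cardinal, so that infinite codimension is not confused with a number. -/
noncomputable def codim (X : Plane → Plane) (hX : SmoothNear X)
    (f : Plane → ℝ) (hf : SmoothNear f) : Cardinal :=
  Module.rank ℝ (FunctionGerm ⧸ tangentIdeal X hX f hf)

/-- The germ of `Y` is of the form `g • X` and has codimension `c` among the multiples of `X`. -/
def HasCodim (X : Plane → Plane) (hX : SmoothNear X) (Y : Plane → Plane) (c : Cardinal) : Prop :=
  ∃ (g : Plane → ℝ) (hg : SmoothNear g),
    Y =ᶠ[𝓝 0] (fun p => g p • X p) ∧ codim X hX g hg = c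

/-- `φ` represents a germ of a smooth diffeomorphism `(ℝ², 0) → (ℝ², 0)`. -/
def IsDiffeoGerm (φ : Plane → Plane) : Prop :=
  φ 0 = 0 ∧ IsLocalDiffeomorphAt 𝓘(ℝ, Plane) 𝓘(ℝ, Plane) ∞ φ 0

/-- `h` represents a germ of a nowhere vanishing smooth function. -/
def IsUnitGerm (h : Plane → ℝ) : Prop :=
  SmoothNear h ∧ h 0 ≠ 0

/-- The pullback `φ^* b` of a 1-form. -/
noncomputable def pullbackForm (φ : Plane → Plane) (b : Plane → Plane →L[ℝ] ℝ) :
    Plane → Plane →L[ℝ] ℝ :=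
  fun p => (b (φ p)).comp (fderiv ℝ φ p)

/-- `φ` is a conformal symmetry of the 1-form `a`: the germ of `a` is `k • φ^* a` for some
nowhere vanishing smooth `k`. -/
def IsConformalSymmetry (a : Plane → Plane →L[ℝ] ℝ) (φ : Plane → Plane) : Prop :=
  IsDiffeoGerm φ ∧ ∃ k : Plane → ℝ, IsUnitGerm k ∧
    a =ᶠ[𝓝 0] (fun p => k p • pullbackForm φ a p)

/-- Orbital `a`-conjugacy of (germs at the origin of) vector fields: `X₁ = h • φ^* X₂` for a
conformal symmetry `φ` of `a` and a nowhere vanishing smooth `h`, where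
`(φ^* X₂)(p) = (d_p φ)⁻¹ (X₂ (φ p))`. -/
def OrbitallyConj (a : Plane → Plane →L[ℝ] ℝ) (X₁ X₂ : Plane → Plane) : Prop :=
  ∃ φ : Plane → Plane, IsConformalSymmetry a φ ∧ ∃ h : Plane → ℝ, IsUnitGerm h ∧
    X₁ =ᶠ[𝓝 0] (fun p => h p • VectorField.pullback ℝ φ X₂ p)

/-- The Liouville form `a_L = x dy`. -/
noncomputable def liouvilleForm : Plane → Plane →L[ℝ] ℝ :=
  fun p => p.1 • ContinuousLinearMap.snd ℝ ℝ ℝ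

/-- The vector field `X_{a_L} = -x ∂/∂x` of the Liouville form. -/
def liouvilleField : Plane → Plane := fun p => (-p.1, 0)

theorem smoothNear_liouvilleField : SmoothNear liouvilleField :=
  Eventually.of_forall fun _ => (contDiff_fst.neg.prodMk contDiff_const).contDiffAt

/-- The field of the Liouville form is its dual with respect to the area form
`ω(u, v) = u₂ v₁ - u₁ v₂`, that is `ω = dy ∧ dx`. (Reversing the orientation changes the sign of the
field, which affects neither codimensions nor conjugacy.) -/
theorem eq_liouvilleField_iff (p u : Plane) :
    u = liouvilleField p ↔ ∀ v : Plane, u.2 * v.1 - u.1 * v.2 = liouvilleForm p v := by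
  constructor
  · rintro rfl v
    simp [liouvilleField, liouvilleForm]
  · intro h
    have h1 := h (1, 0)
    have h2 := h (0, 1)
    simp [liouvilleForm] at h1 h2
    ext
    · simp only [liouvilleField]
      linarith
    · simpa [liouvilleField] using h1

/-- The `k`-jet of `f` at the origin, as the Taylor polynomial of degree `k`. -/
noncomputable def jet (k : ℕ) (f : Plane → ℝ) : Plane → ℝ :=
  fun p => ∑ i ∈ Finset.range (k + 1),
    ((i.factorial : ℝ)⁻¹) * iteratedFDeriv ℝ i f 0 (fun _ => p)

/-- `{f = 0}` is a regular curve through the origin. -/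
def IsRegularCurve (f : Plane → ℝ) : Prop :=
  f 0 = 0 ∧ fderiv ℝ f 0 ≠ 0

/-- The tangent line `ker d₀f` at the origin of the curve `{f = 0}` is transversal to the line
spanned by `v`. -/
def TransversalTo (f : Plane → ℝ) (v : Plane) : Prop :=
  LinearMap.ker (fderiv ℝ f 0 : Plane →ₗ[ℝ] ℝ) ⊔ Submodule.span ℝ {v} = ⊤

/-! Maps of the form `(x, y) ↦ (x u, c y)` with `u(0) ≠ 0` and `c ≠ 0` are conformal symmetries of
`x dy`, and they carry multiples of `X = -x ∂/∂x` to multiples of `X`. Hence `f = h · (g ∘ φ)` for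
such a map `φ` and a unit `h` makes `f X` and `g X` conjugate
(`orbitallyConj_of_eq_mul_comp_axisMap`), and the conjugacies wanted here reduce to a contact
equivalence of functions whose infinitesimal version is the ideal `I = ⟨f, X f⟩`.

Finite determinacy is the homotopy method. If `I` has codimension `k`, Nakayama's lemma in the
finite-dimensional quotient gives `m^k ⊆ I` for the maximal ideal `m`. The remainder `r = f - j^k f`
and its derivative `X r` both lie in `m^(k+1) ⊆ m I`, so along `F_t = f - t r` the equation `∂_t F +
B · X F + A · F = 0` is solvable for every `t` (`axisEquiv_sub`). Integrating it gives equivalences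
between nearby parameters (`eventually_axisEquiv`), and connectedness of `ℝ` links `t = 0` to `t =
1`.

Codimension one means that both partial derivatives are nonzero at a zero of `f`; determinacy leaves
the linear part, and rescaling the axes turns it into `x + y`. Conversely, any conformal symmetry
preserves the vertical axis and has diagonal linear part (`OrbitallyConj.exists_eq_smul`), so a
field conjugate to a multiple of `X` is again a multiple, with codimension computable in the two
cases needed. -/

/-! ### Smooth calculus: cutoffs, smooth dependence of flows, Hadamard's lemma. -/

section SmoothTools

/-- The inverse function theorem, with smoothness of both maps on whole neighbourhoods. -/
theorem exists_openPartialHomeomorph_contDiffOn {E F : Type*} [NormedAddCommGroup E]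
    [NormedSpace ℝ E] [CompleteSpace E] [NormedAddCommGroup F] [NormedSpace ℝ F]
    {f : E → F} {a : E} {e : E ≃L[ℝ] F} (hf : ∀ᶠ x in 𝓝 a, ContDiffAt ℝ ∞ f x)
    (he : HasFDerivAt f (e : E →L[ℝ] F) a) :
    ∃ Φ : OpenPartialHomeomorph E F, a ∈ Φ.source ∧ (Φ : E → F) = f ∧
      ContDiffOn ℝ ∞ f Φ.source ∧ ContDiffOn ℝ ∞ Φ.symm Φ.target := by
  have ha := hf.self_of_nhds
  have hn : (∞ : WithTop ℕ∞) ≠ 0 := by simp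
  have hcont : ContinuousAt (fderiv ℝ f) a := (ha.fderiv_right (m := ∞) (by simp)).continuousAt
  have hinv : ∀ᶠ x in 𝓝 a, fderiv ℝ f x ∈ Set.range ((↑) : (E ≃L[ℝ] F) → E →L[ℝ] F) := by
    refine hcont.eventually ?_
    rw [he.fderiv]
    exact ContinuousLinearEquiv.nhds e
  obtain ⟨s, hs, hso, has⟩ := eventually_nhds_iff.1 (hf.and hinv)
  let Φ₀ := ha.toOpenPartialHomeomorph f he hn
  refine ⟨Φ₀.restrOpen s hso, ?_, rfl, ?_, ?_⟩
  · exact ⟨ha.mem_toOpenPartialHomeomorph_source he hn, has⟩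
  · intro x hx
    exact (hs x hx.2).1.contDiffWithinAt
  · intro y hy
    have hy' : (Φ₀.restrOpen s hso).symm y ∈ (Φ₀.restrOpen s hso).source :=
      (Φ₀.restrOpen s hso).map_target hy
    obtain ⟨h1, e', he'⟩ := hs _ hy'.2
    refine ((Φ₀.restrOpen s hso).contDiffAt_symm (f₀' := e') hy ?_ ?_).contDiffWithinAt
    · rw [he']
      exact (h1.differentiableAt (by simp)).hasFDerivAt
    · exact h1

/-- A map that is smooth near a point agrees near that point with a globally smooth map. -/
theorem exists_contDiff_eventuallyEq {E F : Type*} [NormedAddCommGroup E] [NormedSpace ℝ E]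
    [HasContDiffBump E] [NormedAddCommGroup F] [NormedSpace ℝ F] {f : E → F} {a : E}
    (hf : ∀ᶠ x in 𝓝 a, ContDiffAt ℝ ∞ f x) : ∃ g : E → F, ContDiff ℝ ∞ g ∧ g =ᶠ[𝓝 a] f := by
  obtain ⟨r, hr, hball⟩ := Metric.eventually_nhds_iff_ball.1 hf
  -- The outer radius is below `r`, so the cutoff already vanishes near every point outside the ball
  -- where `f` is smooth.
  let b : ContDiffBump a := ⟨r / 3, r / 2, by positivity, by linarith⟩
  refine ⟨fun x => b x • f x, ?_, ?_⟩
  · rw [contDiff_iff_contDiffAt]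
    intro x
    by_cases hx : x ∈ Metric.ball a r
    · exact b.contDiff.contDiffAt.smul (hball x hx)
    · have : (fun x => b x • f x) =ᶠ[𝓝 x] fun _ => 0 := by
        have hmem : (Metric.closedBall a (r / 2))ᶜ ∈ 𝓝 x := by
          refine Metric.isClosed_closedBall.isOpen_compl.mem_nhds ?_
          simp only [Set.mem_compl_iff, Metric.mem_closedBall, Metric.mem_ball] at hx ⊢
          linarith
        filter_upwards [hmem] with y hy
        rw [b.zero_of_le_dist, zero_smul]
        simp only [Set.mem_compl_iff, Metric.mem_closedBall] at hy
        exact (not_le.1 hy).le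
      exact contDiffAt_const.congr_of_eventuallyEq this
  · filter_upwards [b.eventuallyEq_one] with x hx
    simp [hx]

variable {X : Type*} [TopologicalSpace X] [CompactSpace X]

/-- Pointwise application of a continuous family of operators to a continuous map. -/
noncomputable def pointwiseApply (X : Type*) [TopologicalSpace X] [CompactSpace X]
    (E G : Type*) [NormedAddCommGroup E] [NormedSpace ℝ E]
    [NormedAddCommGroup G] [NormedSpace ℝ G] :
    C(X, E →L[ℝ] G) →L[ℝ] C(X, E) →L[ℝ] C(X, G) :=
  LinearMap.mkContinuous₂
    (LinearMap.mk₂ ℝ (fun (A : C(X, E →L[ℝ] G)) (h : C(X, E)) =>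
        (⟨fun x => A x (h x), A.continuous.clm_apply h.continuous⟩ : C(X, G)))
      (by intros; ext; simp) (by intros; ext; simp) (by intros; ext; simp)
      (by intros; ext; simp)) 1 (by
      intro A h
      rw [one_mul, ContinuousMap.norm_le _ (by positivity)]
      intro x
      exact (A x).le_of_opNorm_le_of_le (A.norm_coe_le_norm x) (h.norm_coe_le_norm x))

theorem pointwiseApply_apply {E G : Type*} [NormedAddCommGroup E] [NormedSpace ℝ E]
    [NormedAddCommGroup G] [NormedSpace ℝ G] (A : C(X, E →L[ℝ] G)) (h : C(X, E)) (x : X) :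
    pointwiseApply X E G A h x = A x (h x) := rfl

/-- Differentiability of the composition operator `γ ↦ g ∘ γ`. -/
theorem hasFDerivAt_postcomp {E G : Type*} [NormedAddCommGroup E] [NormedSpace ℝ E]
    [NormedAddCommGroup G] [NormedSpace ℝ G] (g : C(E, G)) (g' : C(E, E →L[ℝ] G))
    (hg : ∀ x, HasFDerivAt g (g' x) x) (γ : C(X, E)) :
    HasFDerivAt (fun γ : C(X, E) => g.comp γ) (pointwiseApply X E G (g'.comp γ)) γ := by
  rw [hasFDerivAt_iff_isLittleO_nhds_zero, Asymptotics.isLittleO_iff]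
  intro c hc
  -- Since `X` is compact, this is uniform continuity: one `δ` controls the variation of `g'` along
  -- `γ` at all points simultaneously.
  have hcont : ContinuousAt (fun h : C(X, E) => g'.comp (γ + h)) 0 :=
    ((ContinuousMap.continuous_postcomp g').comp (continuous_const.add continuous_id)).continuousAt
  obtain ⟨δ, hδ, hball⟩ := (Metric.continuousAt_iff (α := C(X, E)) (β := C(X, E →L[ℝ] G))).1 hcont c hc
  filter_upwards [Metric.ball_mem_nhds (0 : C(X, E)) hδ] with h hh
  rw [ContinuousMap.norm_le _ (by positivity)]
  intro x
  have hbound : ∀ s ∈ Set.Icc (0 : ℝ) 1, ‖g' (γ x + s • h x) - g' (γ x)‖ ≤ c := by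
    intro s hs
    have h1 : dist (s • h) 0 < δ := by
      rw [dist_zero_right, norm_smul, Real.norm_of_nonneg hs.1]
      rw [Metric.mem_ball, dist_zero_right] at hh
      nlinarith [norm_nonneg h, hs.2]
    have h2 := hball h1
    have h3 := ContinuousMap.dist_apply_le_dist (f := g'.comp (γ + s • h))
      (g := g'.comp (γ + 0)) x
    rw [dist_eq_norm] at h3
    simp only [ContinuousMap.comp_apply, ContinuousMap.add_apply, ContinuousMap.smul_apply,
      add_zero] at h3 h2
    exact h3.trans h2.le
  have hder : ∀ s ∈ Set.Icc (0 : ℝ) 1, HasDerivWithinAt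
      (fun s : ℝ => g (γ x + s • h x) - s • g' (γ x) (h x))
      (g' (γ x + s • h x) (h x) - g' (γ x) (h x)) (Set.Icc 0 1) s := by
    intro s _
    have h1 : HasDerivAt (fun s : ℝ => γ x + s • h x) (h x) s := by
      simpa using ((hasDerivAt_id s).smul_const (h x)).const_add (γ x)
    have h2 := (hg (γ x + s • h x)).comp_hasDerivAt s h1
    have h3 : HasDerivAt (fun s : ℝ => s • g' (γ x) (h x)) (g' (γ x) (h x)) s := by
      simpa using (hasDerivAt_id s).smul_const (g' (γ x) (h x))
    exact (h2.sub h3).hasDerivWithinAt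
  have hmv := norm_image_sub_le_of_norm_deriv_le_segment_01' (C := c * ‖h x‖) hder (by
    intro s hs
    rw [← sub_apply]
    exact (ContinuousLinearMap.le_opNorm _ _).trans
      (mul_le_mul_of_nonneg_right (hbound s ⟨hs.1, hs.2.le⟩) (norm_nonneg _)))
  have heq : (g.comp (γ + h) - g.comp γ - pointwiseApply X E G (g'.comp γ) h) x
      = (g (γ x + (1 : ℝ) • h x) - (1 : ℝ) • g' (γ x) (h x)) -
        (g (γ x + (0 : ℝ) • h x) - (0 : ℝ) • g' (γ x) (h x)) := by
    simp [pointwiseApply_apply]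
    abel
  rw [heq]
  exact hmv.trans (mul_le_mul_of_nonneg_left (h.norm_coe_le_norm x) hc.le)

/-- The composition operator `γ ↦ g ∘ γ` of a smooth map `g` is smooth. -/
theorem contDiff_postcomp {X E G : Type} [TopologicalSpace X] [CompactSpace X]
    [NormedAddCommGroup E] [NormedSpace ℝ E]
    [NormedAddCommGroup G] [NormedSpace ℝ G] (g : C(E, G)) (hg : ContDiff ℝ ∞ g) :
    ContDiff ℝ ∞ (fun γ : C(X, E) => g.comp γ) := by
  rw [contDiff_infty]
  intro n
  -- The derivative at `γ` is pointwise application of `g' ∘ γ`, again a composition operator, now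
  -- with values in `E →L[ℝ] G`; hence the target must vary.
  induction n generalizing G with
  | zero =>
    exact contDiff_zero.2 (ContinuousMap.continuous_postcomp g)
  | succ n ih =>
    have hg' : ContDiff ℝ ∞ (fderiv ℝ g) := hg.fderiv_right (by simp)
    let g' : C(E, E →L[ℝ] G) := ⟨fderiv ℝ g, hg'.continuous⟩
    refine contDiff_succ_iff_hasFDerivAt.2 ⟨fun γ => pointwiseApply X E G (g'.comp γ), ?_, ?_⟩
    · exact (pointwiseApply X E G).contDiff.comp (ih g' hg')
    · exact hasFDerivAt_postcomp g g' fun x => (hg.differentiable (by simp) x).hasFDerivAt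

/-- Integration from `0` of continuous maps on the unit interval. -/
noncomputable def primitive (E : Type*) [NormedAddCommGroup E] [NormedSpace ℝ E] :
    C(unitInterval, E) →L[ℝ] C(unitInterval, E) :=
  LinearMap.mkContinuous
    { toFun := fun γ => ⟨fun s => ∫ t in (0 : ℝ)..s, Set.IccExtend zero_le_one γ t, by
          have h : Continuous (Set.IccExtend (zero_le_one' ℝ) γ) := γ.continuous.Icc_extend'
          exact (intervalIntegral.continuous_primitive
            (fun a b => h.intervalIntegrable a b) 0).comp continuous_subtype_val⟩
      map_add' := fun γ δ => by
        ext s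
        exact intervalIntegral.integral_add
          ((γ.continuous.Icc_extend' (h := zero_le_one)).intervalIntegrable _ _)
          ((δ.continuous.Icc_extend' (h := zero_le_one)).intervalIntegrable _ _)
      map_smul' := fun c γ => by
        ext s
        exact intervalIntegral.integral_smul c _ } 1 (by
    intro γ
    rw [one_mul, ContinuousMap.norm_le _ (norm_nonneg _)]
    intro s
    refine (intervalIntegral.norm_integral_le_of_norm_le_const (C := ‖γ‖)
      fun t _ => γ.norm_coe_le_norm _).trans ?_
    have hs := s.2
    rw [sub_zero, abs_of_nonneg hs.1]
    exact mul_le_of_le_one_right (norm_nonneg _) hs.2)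

theorem primitive_apply {E : Type*} [NormedAddCommGroup E] [NormedSpace ℝ E]
    (γ : C(unitInterval, E)) (s : unitInterval) :
    primitive E γ s = ∫ t in (0 : ℝ)..s, Set.IccExtend zero_le_one γ t := rfl

/-- Local existence of a flow depending smoothly on the initial value and on the time scale. -/
theorem exists_contDiffAt_flow {E : Type} [NormedAddCommGroup E] [NormedSpace ℝ E]
    [CompleteSpace E] {V : E → E} (hV : ContDiff ℝ ∞ V) (x₀ : E) :
    ∃ Γ : ℝ × E → ℝ → E, (∀ᶠ q in 𝓝 ((0 : ℝ), x₀), ContDiffAt ℝ ∞ (fun q => Γ q 1) q) ∧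
      ∀ U ∈ 𝓝 x₀, ∀ᶠ q in 𝓝 ((0 : ℝ), x₀), Γ q 0 = q.2 ∧ ∀ s ∈ Set.Icc (0 : ℝ) 1,
        Γ q s ∈ U ∧ HasDerivWithinAt (Γ q) (q.1 • V (Γ q s)) (Set.Icc 0 1) s := by
  let v : C(E, E) := ⟨V, hV.continuous⟩
  let C := C(unitInterval, E)
  -- The integral equation `γ = x + ε ∫ V(γ)` reads `Ψ (ε, γ) = (ε, const x)`. At `ε = 0` the
  -- derivative of `Ψ` is a shear, so the inverse function theorem on path space gives solutions
  -- depending smoothly on `(ε, x)`.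
  let Ψ : ℝ × C → ℝ × C := fun q => (q.1, q.2 - q.1 • primitive E (v.comp q.2))
  have hΨ : ContDiff ℝ ∞ Ψ := by
    refine contDiff_fst.prodMk (contDiff_snd.sub (contDiff_fst.smul ?_))
    exact (primitive E).contDiff.comp ((contDiff_postcomp v hV).comp contDiff_snd)
  let κ : E →L[ℝ] C := ContinuousLinearMap.const ℝ unitInterval
  let b : C := primitive E (v.comp (κ x₀))
  let S : ℝ →L[ℝ] C := ContinuousLinearMap.toSpanSingleton ℝ b
  let e : (ℝ × C) ≃L[ℝ] (ℝ × C) := ContinuousLinearEquiv.equivOfInverse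
    ((ContinuousLinearMap.fst ℝ ℝ C).prod
      (ContinuousLinearMap.snd ℝ ℝ C - S.comp (ContinuousLinearMap.fst ℝ ℝ C)))
    ((ContinuousLinearMap.fst ℝ ℝ C).prod
      (ContinuousLinearMap.snd ℝ ℝ C + S.comp (ContinuousLinearMap.fst ℝ ℝ C)))
    (fun q => by simp) (fun q => by simp)
  have he : HasFDerivAt Ψ (e : ℝ × C →L[ℝ] ℝ × C) ((0 : ℝ), κ x₀) := by
    have hP : DifferentiableAt ℝ (fun q : ℝ × C => primitive E (v.comp q.2)) ((0 : ℝ), κ x₀) :=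
      ((primitive E).contDiff.comp ((contDiff_postcomp v hV).comp contDiff_snd)).differentiable
        (by simp) _
    refine (hasFDerivAt_fst.prodMk
      (hasFDerivAt_snd.sub (hasFDerivAt_fst.smul hP.hasFDerivAt))).congr_fderiv ?_
    refine ContinuousLinearMap.ext fun q => Prod.ext ?_ ?_
    · simp [e]
    · simp [e, S, b]
  obtain ⟨Φ, hmem, hΦ, -, hsymm⟩ :=
    exists_openPartialHomeomorph_contDiffOn (Eventually.of_forall fun q => hΨ.contDiffAt) he
  have hval : Ψ ((0 : ℝ), κ x₀) = ((0 : ℝ), κ x₀) := by simp [Ψ]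
  have htgt : ((0 : ℝ), κ x₀) ∈ Φ.target := by
    have := Φ.map_source hmem
    rwa [hΦ, hval] at this
  have hsv : Φ.symm ((0 : ℝ), κ x₀) = ((0 : ℝ), κ x₀) := by
    have := Φ.left_inv hmem
    rwa [hΦ, hval] at this
  let ι : ℝ × E → ℝ × C := fun q => (q.1, κ q.2)
  have hι : ContDiff ℝ ∞ ι := contDiff_fst.prodMk (κ.contDiff.comp contDiff_snd)
  have hιtgt : ∀ᶠ q in 𝓝 ((0 : ℝ), x₀), ι q ∈ Φ.target :=
    hι.continuous.continuousAt.eventually (Φ.open_target.mem_nhds htgt)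
  refine ⟨fun q s => Set.IccExtend zero_le_one (Φ.symm (ι q)).2 s, ?_, ?_⟩
  · filter_upwards [hιtgt] with q hq
    have h1 : ContDiffAt ℝ ∞ (fun q => (Φ.symm (ι q)).2) q :=
      contDiffAt_snd.comp q (((hsymm _ hq).contDiffAt (Φ.open_target.mem_nhds hq)).comp q
        hι.contDiffAt)
    have h2 : (fun q => Set.IccExtend (zero_le_one' ℝ) (Φ.symm (ι q)).2 1) =
        fun q => ContinuousMap.evalCLM ℝ (1 : unitInterval) (Φ.symm (ι q)).2 := by
      funext q
      exact Set.IccExtend_right _ _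
    rw [h2]
    exact (ContinuousMap.evalCLM ℝ (1 : unitInterval)).contDiff.contDiffAt.comp q h1
  · intro U hU
    obtain ⟨r, hr, hrU⟩ := Metric.mem_nhds_iff.1 hU
    have hclose : ∀ᶠ q in 𝓝 ((0 : ℝ), x₀), dist (Φ.symm (ι q)).2 (κ x₀) < r := by
      have hc : ContinuousAt (fun q => (Φ.symm (ι q)).2) ((0 : ℝ), x₀) :=
        continuousAt_snd.comp (ContinuousAt.comp (f := ι) (Φ.continuousAt_symm htgt)
          hι.continuous.continuousAt)
      have := hc.eventually (Metric.ball_mem_nhds _ hr)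
      simpa [ι, hsv] using this
    filter_upwards [hιtgt, hclose] with q hq hqr
    have hr1 : Ψ (Φ.symm (ι q)) = ι q := by
      have := Φ.right_inv hq
      rwa [hΦ] at this
    set γ : C := (Φ.symm (ι q)).2
    have hfst : (Φ.symm (ι q)).1 = q.1 := congrArg Prod.fst hr1
    have hsnd : γ - q.1 • primitive E (v.comp γ) = κ q.2 := by
      have := congrArg Prod.snd hr1
      simp only [Ψ, hfst] at this
      exact this
    have hint : ∀ s : unitInterval,
        γ s = q.2 + q.1 • ∫ t in (0 : ℝ)..s, V (Set.IccExtend zero_le_one γ t) := by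
      intro s
      have := congrArg (fun δ : C => δ s) hsnd
      change γ s - q.1 • primitive E (v.comp γ) s = q.2 at this
      rw [sub_eq_iff_eq_add, primitive_apply] at this
      exact this
    have hcont : Continuous fun t => V (Set.IccExtend (zero_le_one' ℝ) γ t) :=
      hV.continuous.comp γ.continuous.Icc_extend'
    refine ⟨?_, fun s hs => ⟨?_, ?_⟩⟩
    · have := hint 0
      have h0 : ((0 : unitInterval) : ℝ) = 0 := rfl
      rw [h0, intervalIntegral.integral_same, smul_zero, add_zero] at this
      rw [← this]
      exact Set.IccExtend_left _ _
    · refine hrU ?_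
      rw [Set.IccExtend_of_mem _ _ hs]
      exact (ContinuousMap.dist_apply_le_dist (f := γ) (g := κ x₀) ⟨s, hs⟩).trans_lt hqr
    · have hd : HasDerivAt
          (fun u => q.2 + q.1 • ∫ t in (0 : ℝ)..u, V (Set.IccExtend (zero_le_one' ℝ) γ t))
          (q.1 • V (Set.IccExtend (zero_le_one' ℝ) γ s)) s :=
        ((intervalIntegral.integral_hasDerivAt_right (hcont.intervalIntegrable _ _)
          (hcont.stronglyMeasurableAtFilter _ _) hcont.continuousAt).const_smul q.1).const_add q.2
      refine hd.hasDerivWithinAt.congr (fun u hu => ?_) ?_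
      · rw [Set.IccExtend_of_mem _ _ hu]
        exact hint ⟨u, hu⟩
      · rw [Set.IccExtend_of_mem _ _ hs]
        exact hint ⟨s, hs⟩

/-- Hadamard's lemma in the first variable. -/
theorem exists_contDiff_eq_add_fst_mul {f : Plane → ℝ} (hf : ContDiff ℝ ∞ f) :
    ∃ u : Plane → ℝ, ContDiff ℝ ∞ u ∧ ∀ p, f p = f (0, p.2) + p.1 * u p := by
  have hf1 : ContDiff ℝ ∞ (fun p => fderiv ℝ f p (1, 0)) :=
    (hf.fderiv_right (m := ∞) (by simp)).clm_apply contDiff_const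
  let g : C(Plane, ℝ) := ⟨fun p => fderiv ℝ f p (1, 0), hf1.continuous⟩
  -- The quotient is `∫₀¹ ∂₁f(s x, y) ds`. Its smoothness comes from writing it as a linear map into
  -- path space, a composition operator, integration and evaluation at `1`.
  let seg : Plane →L[ℝ] C(unitInterval, Plane) := LinearMap.mkContinuous
    { toFun := fun p => ⟨fun s => ((s : ℝ) * p.1, p.2), by fun_prop⟩
      map_add' := fun p q => by ext s <;> simp [mul_add]
      map_smul' := fun c p => by ext s <;> simp [mul_left_comm] } 1 (by
    intro p
    rw [one_mul, ContinuousMap.norm_le _ (norm_nonneg _)]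
    intro s
    refine max_le ?_ (norm_snd_le p)
    refine le_trans ?_ (norm_fst_le p)
    change ‖(s : ℝ) * p.1‖ ≤ ‖p.1‖
    rw [norm_mul, Real.norm_of_nonneg s.2.1]
    exact mul_le_of_le_one_left (norm_nonneg _) s.2.2)
  refine ⟨fun p => primitive ℝ (g.comp (seg p)) 1, ?_, fun p => ?_⟩
  · exact (ContinuousMap.evalCLM ℝ (1 : unitInterval)).contDiff.comp
      ((primitive ℝ).contDiff.comp ((contDiff_postcomp g hf1).comp seg.contDiff))
  · have hd : ∀ s : ℝ, HasDerivAt (fun s => f (s * p.1, p.2))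
        (p.1 * fderiv ℝ f (s * p.1, p.2) (1, 0)) s := by
      intro s
      have h1 : HasDerivAt (fun s : ℝ => (s * p.1, p.2)) (p.1, (0 : ℝ)) s := by
        simpa using ((hasDerivAt_id s).mul_const p.1).prodMk (hasDerivAt_const s p.2)
      have h2 := ((hf.differentiable (by simp) (s * p.1, p.2)).hasFDerivAt).comp_hasDerivAt s h1
      have h3 : (p.1, (0 : ℝ)) = p.1 • ((1 : ℝ), (0 : ℝ)) := by simp
      rw [h3, map_smul, smul_eq_mul] at h2
      exact h2
    have hc : Continuous fun s : ℝ => fderiv ℝ f (s * p.1, p.2) (1, 0) :=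
      hf1.continuous.comp (by fun_prop)
    have hint := intervalIntegral.integral_eq_sub_of_hasDerivAt (a := 0) (b := 1)
      (fun s _ => hd s) ((continuous_const.mul hc).intervalIntegrable _ _)
    rw [intervalIntegral.integral_const_mul] at hint
    have heq : primitive ℝ (g.comp (seg p)) 1 =
        ∫ s in (0 : ℝ)..1, fderiv ℝ f (s * p.1, p.2) (1, 0) := by
      rw [primitive_apply]
      refine intervalIntegral.integral_congr fun s hs => ?_
      have hs : s ∈ Set.Icc (0 : ℝ) 1 := by simpa using hs
      simp only [Set.IccExtend_of_mem _ _ hs]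
      rfl
    change f p = f (0, p.2) + p.1 * primitive ℝ (g.comp (seg p)) 1
    rw [heq, hint]
    simp

end SmoothTools

/-! ### The local ring of germs and Nakayama's lemma. -/

section GermRing

theorem SmoothNear.add {f g : Plane → ℝ} (hf : SmoothNear f) (hg : SmoothNear g) :
    SmoothNear (fun p => f p + g p) :=
  smoothNearFunctions.add_mem hf hg

theorem SmoothNear.mul {f g : Plane → ℝ} (hf : SmoothNear f) (hg : SmoothNear g) :
    SmoothNear (fun p => f p * g p) :=
  smoothNearFunctions.mul_mem hf hg

theorem SmoothNear.sub {f g : Plane → ℝ} (hf : SmoothNear f) (hg : SmoothNear g) :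
    SmoothNear (fun p => f p - g p) :=
  smoothNearFunctions.sub_mem hf hg

theorem ContDiff.smoothNear {F : Type*} [NormedAddCommGroup F] [NormedSpace ℝ F] {f : Plane → F}
    (hf : ContDiff ℝ ∞ f) : SmoothNear f :=
  Eventually.of_forall fun _ => hf.contDiffAt

theorem SmoothNear.congr {F : Type*} [NormedAddCommGroup F] [NormedSpace ℝ F] {f g : Plane → F}
    (hf : SmoothNear f) (h : f =ᶠ[𝓝 0] g) : SmoothNear g := by
  filter_upwards [hf, h.eventuallyEq_nhds] with p h1 h2
  exact h1.congr_of_eventuallyEq h2.symm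

theorem SmoothNear.inv {f : Plane → ℝ} (hf : SmoothNear f) (h0 : f 0 ≠ 0) :
    SmoothNear (fun p => (f p)⁻¹) := by
  filter_upwards [hf, hf.self_of_nhds.continuousAt.eventually_ne h0] with p h1 h2
  exact h1.inv h2

theorem SmoothNear.eventually_differentiableAt {F : Type*} [NormedAddCommGroup F]
    [NormedSpace ℝ F] {f : Plane → F} (hf : SmoothNear f) :
    ∀ᶠ p in 𝓝 (0 : Plane), DifferentiableAt ℝ f p := by
  filter_upwards [hf] with p hp
  exact hp.differentiableAt (by simp)

theorem smoothNear_fst : SmoothNear (fun p => p.1) := contDiff_fst.smoothNear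

theorem smoothNear_snd : SmoothNear (fun p => p.2) := contDiff_snd.smoothNear

theorem smoothNear_const (c : ℝ) : SmoothNear (fun _ => c) := contDiff_const.smoothNear

theorem functionGerm_eq_iff {f g : Plane → ℝ} (hf : SmoothNear f) (hg : SmoothNear g) :
    functionGerm f hf = functionGerm g hg ↔ f =ᶠ[𝓝 0] g := by
  refine (Ideal.Quotient.eq (I := vanishingNear)).trans ?_
  change (fun p => f p - g p) =ᶠ[𝓝 0] 0 ↔ _
  exact eventuallyEq_iff_sub.symm

theorem exists_functionGerm_eq (z : FunctionGerm) :
    ∃ (f : Plane → ℝ) (hf : SmoothNear f), functionGerm f hf = z := by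
  obtain ⟨⟨f, hf⟩, rfl⟩ := Ideal.Quotient.mk_surjective z
  exact ⟨f, hf, rfl⟩

/-- Evaluation of germs at the origin. -/
noncomputable def evalGerm : FunctionGerm →ₐ[ℝ] ℝ :=
  Ideal.Quotient.liftₐ vanishingNear
    ((Pi.evalAlgHom ℝ (fun _ : Plane => ℝ) 0).comp smoothNearFunctions.val)
    (fun _ ha => EventuallyEq.eq_of_nhds (f := ((_ : smoothNearFunctions) : Plane → ℝ)) ha)

theorem evalGerm_functionGerm {f : Plane → ℝ} (hf : SmoothNear f) :
    evalGerm (functionGerm f hf) = f 0 := rfl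

theorem evalGerm_surjective : Function.Surjective evalGerm := fun c =>
  ⟨functionGerm _ (smoothNear_const c), rfl⟩

theorem isUnit_of_evalGerm_ne_zero {z : FunctionGerm} (hz : evalGerm z ≠ 0) : IsUnit z := by
  obtain ⟨f, hf, rfl⟩ := exists_functionGerm_eq z
  refine IsUnit.of_mul_eq_one (functionGerm _ (hf.inv hz)) ?_
  refine (functionGerm_eq_iff _ (smoothNear_const 1)).2 ?_
  filter_upwards [hf.self_of_nhds.continuousAt.eventually_ne hz] with p hp
  exact mul_inv_cancel₀ hp

/-- If `z` vanishes at the origin, every `z y + 1` takes the value `1` there and is a unit. This is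
the form of locality that Nakayama's lemma needs. -/
theorem ker_evalGerm_le_jacobson : RingHom.ker evalGerm ≤ Ideal.jacobson ⊥ := by
  intro z hz
  rw [Ideal.mem_jacobson_bot]
  intro y
  refine isUnit_of_evalGerm_ne_zero ?_
  simp [RingHom.mem_ker.1 hz]

/-- If `I` has codimension `k`, the `k`-th power of any ideal in the radical lies in `I`. -/
theorem Ideal.pow_le_of_rank_quotient_eq {K R : Type*} [Field K] [CommRing R] [Algebra K R]
    {m I : Ideal R} (hm : m ≤ Ideal.jacobson ⊥) {k : ℕ}
    (hk : Module.rank K (R ⧸ I) = k) : m ^ k ≤ I := by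
  have hfin : Module.Finite K (R ⧸ I) :=
    Module.rank_lt_aleph0_iff.1 (hk ▸ Cardinal.natCast_lt_aleph0)
  have hfr : Module.finrank K (R ⧸ I) = k := Module.finrank_eq_of_rank_eq hk
  have hnoeth : IsNoetherianRing (R ⧸ I) := isNoetherian_of_tower K inferInstance
  set q := Ideal.Quotient.mk I
  have hjac : m.map q ≤ Ideal.jacobson ⊥ := by
    rw [Ideal.map_le_iff_le_comap]
    intro z hz
    rw [Ideal.mem_comap, Ideal.mem_jacobson_bot]
    intro y
    obtain ⟨y, rfl⟩ := Ideal.Quotient.mk_surjective y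
    have := (Ideal.mem_jacobson_bot.1 (hm hz) y).map q
    simpa using this
  -- In the chain of powers of the image of `m`, a strict inclusion lowers the dimension by at least
  -- one, and an equality forces the power to be zero by Nakayama. So `k` steps exhaust the
  -- quotient.
  have hdim : ∀ j ≤ k, Module.finrank K (((m.map q) ^ j).restrictScalars K) ≤ k - j := by
    intro j
    induction j with
    | zero => intro _; exact (Submodule.finrank_le _).trans hfr.le
    | succ j ih =>
      intro hj
      have h1 := ih (by omega)
      have hle : (m.map q) ^ (j + 1) ≤ (m.map q) ^ j := Ideal.pow_le_pow_right (by omega)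
      rcases hle.eq_or_lt with heq | hlt
      · have hbot : (m.map q) ^ j = ⊥ :=
          Submodule.eq_bot_of_le_smul_of_le_jacobson_bot (m.map q) _
            (IsNoetherian.noetherian _) (by rw [smul_eq_mul, ← pow_succ', heq]) hjac
        rw [heq, hbot, Submodule.restrictScalars_bot, finrank_bot]
        exact Nat.zero_le _
      · have : ((m.map q) ^ (j + 1)).restrictScalars K < ((m.map q) ^ j).restrictScalars K := hlt
        have := Submodule.finrank_lt_finrank_of_lt this
        omega
  have h0 : Module.finrank K (((m.map q) ^ k).restrictScalars K) = 0 := by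
    have := hdim k le_rfl
    omega
  have hbot : (m.map q) ^ k = ⊥ := by
    have := Submodule.finrank_eq_zero.1 h0
    exact (Submodule.restrictScalars_eq_bot_iff K _ _).1 this
  rw [← Ideal.map_pow] at hbot
  have := Ideal.map_eq_bot_iff_le_ker q |>.1 hbot
  rwa [Ideal.mk_ker] at this

/-- The point is that both coefficients can be taken in `m`; for germs they then vanish at the
origin, which keeps the homotopy equation solvable. -/
theorem exists_of_mem_mul_span_pair {R : Type*} [CommRing R] {m : Ideal R} {a b r : R}
    (hr : r ∈ m * Ideal.span {a, b}) : ∃ α ∈ m, ∃ β ∈ m, r = α * a + β * b := by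
  rw [Ideal.span_insert, Ideal.mul_sup] at hr
  obtain ⟨s, hs, t, ht, rfl⟩ := Submodule.mem_sup.1 hr
  obtain ⟨α, hα, rfl⟩ := Ideal.mem_mul_span_singleton.1 hs
  obtain ⟨β, hβ, rfl⟩ := Ideal.mem_mul_span_singleton.1 ht
  exact ⟨α, hα, β, hβ, rfl⟩

end GermRing

/-! ### Order of vanishing and Taylor polynomials. -/

section Order

/-- The function is a combination of monomials of degree `n` with smooth coefficients. -/
def VanishesToOrder : ℕ → (Plane → ℝ) → Prop
  | 0, f => SmoothNear f
  | n + 1, f => ∃ a b, VanishesToOrder n a ∧ VanishesToOrder n b ∧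
      f =ᶠ[𝓝 0] fun p => p.1 * a p + p.2 * b p

theorem VanishesToOrder.smoothNear {n : ℕ} {f : Plane → ℝ} (hf : VanishesToOrder n f) :
    SmoothNear f := by
  induction n generalizing f with
  | zero => exact hf
  | succ n ih =>
    obtain ⟨a, b, ha, hb, h⟩ := hf
    exact ((smoothNear_fst.mul (ih ha)).add (smoothNear_snd.mul (ih hb))).congr h.symm

theorem VanishesToOrder.congr {n : ℕ} {f g : Plane → ℝ} (hf : VanishesToOrder n f)
    (h : f =ᶠ[𝓝 0] g) : VanishesToOrder n g := by
  cases n with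
  | zero => exact SmoothNear.congr hf h
  | succ n =>
    obtain ⟨a, b, ha, hb, hab⟩ := hf
    exact ⟨a, b, ha, hb, h.symm.trans hab⟩

theorem VanishesToOrder.sub {n : ℕ} {f g : Plane → ℝ} (hf : VanishesToOrder n f)
    (hg : VanishesToOrder n g) : VanishesToOrder n (fun p => f p - g p) := by
  induction n generalizing f g with
  | zero => exact SmoothNear.sub hf hg
  | succ n ih =>
    obtain ⟨a, b, ha, hb, h⟩ := hf
    obtain ⟨a', b', ha', hb', h'⟩ := hg
    refine ⟨_, _, ih ha ha', ih hb hb', ?_⟩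
    filter_upwards [h, h'] with p h1 h2
    rw [h1, h2]
    ring

theorem lieDerivative_congr (X : Plane → Plane) {f g : Plane → ℝ} (h : f =ᶠ[𝓝 0] g) :
    lieDerivative X f =ᶠ[𝓝 0] lieDerivative X g := by
  filter_upwards [h.eventuallyEq_nhds] with p hp
  simp only [lieDerivative, hp.fderiv_eq]

/-- Since `X x = -x` and `X y = 0`, one has `X (x a + y b) = x (X a - a) + y X b`, so no order is
lost. -/
theorem VanishesToOrder.lieDerivative {n : ℕ} {f : Plane → ℝ} (hf : VanishesToOrder n f) :
    VanishesToOrder n (lieDerivative liouvilleField f) := by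
  induction n generalizing f with
  | zero => exact smoothNear_liouvilleField.lieDerivative hf
  | succ n ih =>
    obtain ⟨a, b, ha, hb, h⟩ := hf
    refine ⟨_, _, (ih ha).sub ha, ih hb, (lieDerivative_congr _ h).trans ?_⟩
    filter_upwards [ha.smoothNear.eventually_differentiableAt,
      hb.smoothNear.eventually_differentiableAt] with p h1 h2
    have hd := (hasFDerivAt_fst.mul h1.hasFDerivAt).add (hasFDerivAt_snd.mul h2.hasFDerivAt)
    simp only [_root_.lieDerivative]
    refine (congrArg (fun L : Plane →L[ℝ] ℝ => L (liouvilleField p)) hd.fderiv).trans ?_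
    simp [liouvilleField]
    ring

theorem VanishesToOrder.functionGerm_mem {n : ℕ} {f : Plane → ℝ} (hf : VanishesToOrder n f) :
    functionGerm f hf.smoothNear ∈ RingHom.ker evalGerm ^ n := by
  induction n generalizing f with
  | zero => simp
  | succ n ih =>
    obtain ⟨a, b, ha, hb, h⟩ := id hf
    have : functionGerm f hf.smoothNear =
        functionGerm _ smoothNear_fst * functionGerm a ha.smoothNear +
          functionGerm _ smoothNear_snd * functionGerm b hb.smoothNear :=
      (functionGerm_eq_iff _ ((smoothNear_fst.mul ha.smoothNear).add
        (smoothNear_snd.mul hb.smoothNear))).2 h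
    rw [this, pow_succ']
    exact Ideal.add_mem _ (Ideal.mul_mem_mul (RingHom.mem_ker.2 rfl) (ih ha))
      (Ideal.mul_mem_mul (RingHom.mem_ker.2 rfl) (ih hb))

/-- Hadamard's lemma at the origin. -/
theorem exists_contDiff_eq_add_mul {f : Plane → ℝ} (hf : ContDiff ℝ ∞ f) :
    ∃ a b : Plane → ℝ, ContDiff ℝ ∞ a ∧ ContDiff ℝ ∞ b ∧
      ∀ p, f p = f 0 + (p.1 * a p + p.2 * b p) := by
  obtain ⟨a, ha, h1⟩ := exists_contDiff_eq_add_fst_mul hf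
  -- The second variable is moved to the first slot, where the one-variable division applies again.
  have hg : ContDiff ℝ ∞ fun p : Plane => f (0, p.1) :=
    hf.comp (contDiff_const.prodMk contDiff_fst)
  obtain ⟨b, hb, h2⟩ := exists_contDiff_eq_add_fst_mul hg
  refine ⟨a, fun p => b (p.2, 0), ha, hb.comp (contDiff_snd.prodMk contDiff_const), fun p => ?_⟩
  have h3 := h2 (p.2, 0)
  simp only at h3
  rw [h1 p, h3, Prod.mk_zero_zero]
  ring

/-- Restriction to the line `t ↦ t p` reduces jets to Taylor coefficients of functions of one
variable. -/
theorem jet_eq_sum_iteratedDeriv {f : Plane → ℝ} (hf : ContDiff ℝ ∞ f) (k : ℕ) (p : Plane) :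
    jet k f p = ∑ i ∈ Finset.range (k + 1),
      ((i.factorial : ℝ)⁻¹) * iteratedDeriv i (fun t : ℝ => f (t • p)) 0 := by
  refine Finset.sum_congr rfl fun i _ => ?_
  have h := (ContinuousLinearMap.toSpanSingleton ℝ p).iteratedFDeriv_comp_right hf (0 : ℝ)
    (i := i) (by exact_mod_cast le_top)
  have h2 : iteratedDeriv i (fun t : ℝ => f (t • p)) 0 =
      iteratedFDeriv ℝ i (f ∘ ContinuousLinearMap.toSpanSingleton ℝ p) 0 (fun _ => 1) :=
    iteratedDeriv_eq_iteratedFDeriv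
  rw [h2, h]
  simp

theorem jet_congr {f g : Plane → ℝ} (h : f =ᶠ[𝓝 0] g) (k : ℕ) : jet k f = jet k g := by
  funext p
  refine Finset.sum_congr rfl fun i _ => ?_
  rw [(h.iteratedFDeriv ℝ i).eq_of_nhds]

/-- In the Leibniz formula at `0` only the term with exactly one derivative on `t` survives. Its
binomial coefficient `i + 1` turns `1/(i+1)!` into `1/i!` in `jet_succ_of_eq`. -/
theorem iteratedDeriv_succ_const_add_id_mul {g : ℝ → ℝ} (hg : ContDiff ℝ ∞ g) (c : ℝ) (i : ℕ) :
    iteratedDeriv (i + 1) (fun t => c + t * g t) 0 = (i + 1) * iteratedDeriv i g 0 := by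
  have hle : ((i + 1 : ℕ) : WithTop ℕ∞) ≤ ∞ := by exact_mod_cast le_top
  rw [iteratedDeriv_const_add (by omega),
    iteratedDeriv_fun_mul contDiffAt_fun_id (hg.contDiffAt.of_le hle),
    Finset.sum_eq_single 1]
  · simp [iteratedDeriv_one]
  · intro j _ hj
    have : iteratedDeriv j (fun t : ℝ => t) 0 = 0 := by
      have := iteratedDeriv_fun_id (𝕜 := ℝ) (n := j) (x := 0)
      rcases j with _ | _ | j
      · simp
      · exact absurd rfl hj
      · simp_all
    rw [this]
    simp
  · simp

/-- Taking jets commutes with Hadamard's decomposition, at the cost of one degree. By induction the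
Taylor remainder acquires its order of vanishing without any integral remainder formula. -/
theorem jet_succ_of_eq {f a b : Plane → ℝ} (hf : ContDiff ℝ ∞ f) (ha : ContDiff ℝ ∞ a)
    (hb : ContDiff ℝ ∞ b) (h : ∀ p, f p = f 0 + (p.1 * a p + p.2 * b p)) (k : ℕ) (p : Plane) :
    jet (k + 1) f p = f 0 + (p.1 * jet k a p + p.2 * jet k b p) := by
  rw [jet_eq_sum_iteratedDeriv hf, jet_eq_sum_iteratedDeriv ha, jet_eq_sum_iteratedDeriv hb,
    Finset.sum_range_succ', Finset.mul_sum, Finset.mul_sum, ← Finset.sum_add_distrib, add_comm]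
  congr 1
  · simp
  · refine Finset.sum_congr rfl fun i _ => ?_
    have hline : ContDiff ℝ ∞ fun t : ℝ => t • p := by fun_prop
    have ha' : ContDiff ℝ ∞ fun t : ℝ => a (t • p) := ha.comp hline
    have hb' : ContDiff ℝ ∞ fun t : ℝ => b (t • p) := hb.comp hline
    have hle : ((i : ℕ) : WithTop ℕ∞) ≤ ∞ := by exact_mod_cast le_top
    have heq : (fun t : ℝ => f (t • p)) =
        fun t => f 0 + t * (p.1 * a (t • p) + p.2 * b (t • p)) := by
      funext t
      rw [h]
      simp only [Prod.smul_fst, Prod.smul_snd, smul_eq_mul]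
      ring
    rw [heq, iteratedDeriv_succ_const_add_id_mul
        ((contDiff_const.mul ha').add (contDiff_const.mul hb')),
      iteratedDeriv_fun_add ((contDiff_const.mul ha').contDiffAt.of_le hle)
        ((contDiff_const.mul hb').contDiffAt.of_le hle),
      iteratedDeriv_const_mul_field, iteratedDeriv_const_mul_field, Nat.factorial_succ]
    push_cast
    field_simp

theorem vanishesToOrder_sub_jet {f : Plane → ℝ} (hf : ContDiff ℝ ∞ f) (k : ℕ) :
    VanishesToOrder (k + 1) (fun p => f p - jet k f p) := by
  induction k generalizing f with
  | zero =>
    obtain ⟨a, b, ha, hb, h⟩ := exists_contDiff_eq_add_mul hf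
    refine ⟨a, b, ha.smoothNear, hb.smoothNear, Eventually.of_forall fun p => ?_⟩
    simp only [h p, jet]
    simp
  | succ k ih =>
    obtain ⟨a, b, ha, hb, h⟩ := exists_contDiff_eq_add_mul hf
    refine ⟨_, _, ih ha, ih hb, Eventually.of_forall fun p => ?_⟩
    simp only [jet_succ_of_eq hf ha hb h, h p]
    ring

theorem SmoothNear.vanishesToOrder_sub_jet {f : Plane → ℝ} (hf : SmoothNear f) (k : ℕ) :
    VanishesToOrder (k + 1) (fun p => f p - jet k f p) := by
  obtain ⟨g, hg, hgf⟩ := exists_contDiff_eventuallyEq hf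
  refine (_root_.vanishesToOrder_sub_jet hg k).congr ?_
  rw [jet_congr hgf]
  filter_upwards [hgf] with p hp
  rw [hp]

end Order

/-! ### The homotopy method and finite determinacy. -/

section ContactEquivalence

theorem SmoothNear.comp {F : Type*} [NormedAddCommGroup F] [NormedSpace ℝ F] {g : Plane → F}
    {φ : Plane → Plane} (hg : SmoothNear g) (hφ : SmoothNear φ) (h0 : φ 0 = 0) :
    SmoothNear (fun p => g (φ p)) := by
  have ht : Tendsto φ (𝓝 0) (𝓝 0) := by
    have := hφ.self_of_nhds.continuousAt.tendsto
    rwa [h0] at this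
  filter_upwards [hφ, ht.eventually hg] with p h1 h2
  exact h2.comp p h1

/-- The map `(x, y) ↦ (x u(x, y), c y)`. -/
def axisMap (u : Plane → ℝ) (c : ℝ) : Plane → Plane := fun p => (p.1 * u p, c * p.2)

theorem axisMap_zero (u : Plane → ℝ) (c : ℝ) : axisMap u c 0 = 0 := by
  simp [axisMap]

theorem SmoothNear.axisMap {u : Plane → ℝ} (hu : SmoothNear u) (c : ℝ) :
    SmoothNear (axisMap u c) := by
  filter_upwards [smoothNear_fst.mul hu, (smoothNear_const c).mul smoothNear_snd] with p h1 h2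
  exact h1.prodMk h2

theorem SmoothNear.tendsto_axisMap {u : Plane → ℝ} (hu : SmoothNear u) (c : ℝ) :
    Tendsto (_root_.axisMap u c) (𝓝 0) (𝓝 0) := by
  have := (hu.axisMap c).self_of_nhds.continuousAt.tendsto
  rwa [axisMap_zero] at this

/-- Contact equivalence by maps that preserve the vertical axis and every horizontal line. -/
def AxisEquiv (f g : Plane → ℝ) : Prop :=
  ∃ u h : Plane → ℝ, IsUnitGerm u ∧ IsUnitGerm h ∧
    ∀ᶠ p in 𝓝 (0 : Plane), f p = h p * g (axisMap u 1 p)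

theorem AxisEquiv.congr {f g f' g' : Plane → ℝ} (h : AxisEquiv f g) (hf : f =ᶠ[𝓝 0] f')
    (hg : g =ᶠ[𝓝 0] g') : AxisEquiv f' g' := by
  obtain ⟨u, k, hu, hk, hfg⟩ := h
  refine ⟨u, k, hu, hk, ?_⟩
  filter_upwards [hf, (hu.1.tendsto_axisMap 1).eventually hg, hfg] with p h1 h2 h3
  rw [← h1, ← h2, h3]

theorem AxisEquiv.trans {f g k : Plane → ℝ} (hfg : AxisEquiv f g) (hgk : AxisEquiv g k) :
    AxisEquiv f k := by
  obtain ⟨u, h, hu, hh, h1⟩ := hfg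
  obtain ⟨u', h', hu', hh', h2⟩ := hgk
  have hφ := hu.1.axisMap 1
  have h0 := axisMap_zero u 1
  refine ⟨fun p => u p * u' (axisMap u 1 p), fun p => h p * h' (axisMap u 1 p),
    ⟨hu.1.mul (hu'.1.comp hφ h0), ?_⟩, ⟨hh.1.mul (hh'.1.comp hφ h0), ?_⟩, ?_⟩
  · simp only [h0]
    exact mul_ne_zero hu.2 hu'.2
  · simp only [h0]
    exact mul_ne_zero hh.2 hh'.2
  · filter_upwards [h1, (hu.1.tendsto_axisMap 1).eventually h2] with p e1 e2
    rw [e1, e2, mul_assoc]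
    congr 3
    simp [axisMap, mul_assoc]

theorem eq_of_hasDerivWithinAt_zero {E : Type*} [NormedAddCommGroup E] [NormedSpace ℝ E]
    {f : ℝ → E} (hf : ∀ s ∈ Set.Icc (0 : ℝ) 1, HasDerivWithinAt f 0 (Set.Icc 0 1) s) :
    f 1 = f 0 := by
  have := norm_image_sub_le_of_norm_deriv_le_segment_01' (C := 0) hf (by simp)
  exact sub_eq_zero.1 (norm_le_zero_iff.1 this)

theorem hasDerivWithinAt_fst_comp {E F : Type*} [NormedAddCommGroup E] [NormedSpace ℝ E]
    [NormedAddCommGroup F] [NormedSpace ℝ F] {γ : ℝ → E × F} {v : E × F} {s : Set ℝ} {σ : ℝ}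
    (h : HasDerivWithinAt γ v s σ) : HasDerivWithinAt (fun σ => (γ σ).1) v.1 s σ :=
  (hasFDerivAt_fst (𝕜 := ℝ) (p := γ σ)).comp_hasDerivWithinAt σ h

theorem hasDerivWithinAt_snd_comp {E F : Type*} [NormedAddCommGroup E] [NormedSpace ℝ E]
    [NormedAddCommGroup F] [NormedSpace ℝ F] {γ : ℝ → E × F} {v : E × F} {s : Set ℝ} {σ : ℝ}
    (h : HasDerivWithinAt γ v s σ) : HasDerivWithinAt (fun σ => (γ σ).2) v.2 s σ :=
  (hasFDerivAt_snd (𝕜 := ℝ) (p := γ σ)).comp_hasDerivWithinAt σ h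

/-- An infinitesimally trivial deformation is locally trivial in the parameter. -/
theorem eventually_axisEquiv {F A B : ℝ × Plane → ℝ} (hF : ContDiff ℝ ∞ F) (t₀ : ℝ)
    (hA : ∀ᶠ q in 𝓝 (t₀, (0 : Plane)), ContDiffAt ℝ ∞ A q)
    (hB : ∀ᶠ q in 𝓝 (t₀, (0 : Plane)), ContDiffAt ℝ ∞ B q)
    (hFAB : ∀ᶠ q in 𝓝 (t₀, (0 : Plane)), fderiv ℝ F q (1, 0) +
      B q * fderiv ℝ F q (0, liouvilleField q.2) + A q * F q = 0) :
    ∀ᶠ st in 𝓝 (t₀, t₀), AxisEquiv (fun p => F (st.1, p)) (fun p => F (st.2, p)) := by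
  -- A state `(t, λ, μ, p)` stands for the time `t`, the point `(x e^λ, y)` and the multiplier
  -- `e^(-μ)`. Integrating `λ` instead of the point yields the unit `u = e^λ` directly, with no
  -- division by `x`.
  let m : ℝ × ℝ × ℝ × Plane → ℝ × Plane :=
    fun z => (z.1, (z.2.2.2.1 * Real.exp z.2.1, z.2.2.2.2))
  let z₀ : ℝ × ℝ × ℝ × Plane := (t₀, 0, 0, 0)
  have hm : ContDiff ℝ ∞ m := by fun_prop
  have hm0 : m z₀ = (t₀, 0) := by simp [m, z₀]
  have hmt : Tendsto m (𝓝 z₀) (𝓝 (t₀, 0)) := hm0 ▸ hm.continuous.tendsto z₀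
  let W : ℝ × ℝ × ℝ × Plane → ℝ × ℝ × ℝ × Plane := fun z => (1, -B (m z), -A (m z), 0)
  have hW : ∀ᶠ z in 𝓝 z₀, ContDiffAt ℝ ∞ W z := by
    filter_upwards [hmt.eventually hA, hmt.eventually hB] with z h1 h2
    exact contDiffAt_const.prodMk ((h2.comp z hm.contDiffAt).neg.prodMk
      ((h1.comp z hm.contDiffAt).neg.prodMk contDiffAt_const))
  -- The flow lemma needs a global field; for nearby data the trajectories stay where `V` equals
  -- `W`.
  obtain ⟨V, hV, hVW⟩ := exists_contDiff_eventuallyEq hW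
  obtain ⟨Γ, hΓs, hΓ⟩ := exists_contDiffAt_flow hV z₀
  have hflow := hΓ _ (hVW.and (hmt.eventually hFAB))
  -- The time scale is `t - s` and the initial state is `(s, 0, 0, p)`, so the unit-time trajectory
  -- runs from parameter `s` to parameter `t`.
  let j : (ℝ × ℝ) × Plane → ℝ × (ℝ × ℝ × ℝ × Plane) := fun r => (r.1.2 - r.1.1, r.1.1, 0, 0, r.2)
  have hj : ContDiff ℝ ∞ j := by fun_prop
  have hjt : Tendsto j (𝓝 ((t₀, t₀), 0)) (𝓝 (0, z₀)) := by
    have : j ((t₀, t₀), 0) = (0, z₀) := by simp [j, z₀]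
    exact this ▸ hj.continuous.tendsto _
  have hall := hjt.eventually (hΓs.and hflow)
  rw [nhds_prod_eq] at hall
  filter_upwards [hall.curry] with st hst
  obtain ⟨s, t⟩ := st
  have hsm : ∀ᶠ p in 𝓝 (0 : Plane), ContDiffAt ℝ ∞ (fun p => Γ (j ((s, t), p)) 1) p := by
    filter_upwards [hst] with p hp
    exact hp.1.comp p (hj.contDiffAt.comp p (contDiffAt_const.prodMk contDiffAt_id))
  refine ⟨fun p => Real.exp (Γ (j ((s, t), p)) 1).2.1,
    fun p => Real.exp (-(Γ (j ((s, t), p)) 1).2.2.1), ⟨?_, (Real.exp_pos _).ne'⟩,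
    ⟨?_, (Real.exp_pos _).ne'⟩, ?_⟩
  · filter_upwards [hsm] with p hp
    exact (contDiffAt_fst.comp p (contDiffAt_snd.comp p hp)).exp
  · filter_upwards [hsm] with p hp
    exact (contDiffAt_fst.comp p (contDiffAt_snd.comp p (contDiffAt_snd.comp p hp))).neg.exp
  · filter_upwards [hst] with p hp
    obtain ⟨-, hp0, hp1⟩ := hp
    set γ := Γ (j ((s, t), p))
    have hε : (j ((s, t), p)).1 = t - s := rfl
    have hder : ∀ σ ∈ Set.Icc (0 : ℝ) 1,
        HasDerivWithinAt γ ((t - s) • W (γ σ)) (Set.Icc 0 1) σ := by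
      intro σ hσ
      have := (hp1 σ hσ).2
      rwa [(hp1 σ hσ).1.1, hε] at this
    have d1 : ∀ σ ∈ Set.Icc (0 : ℝ) 1,
        HasDerivWithinAt (fun σ => (γ σ).1) (t - s) (Set.Icc 0 1) σ := fun σ hσ => by
      simpa [W] using hasDerivWithinAt_fst_comp (hder σ hσ)
    have d2 : ∀ σ ∈ Set.Icc (0 : ℝ) 1, HasDerivWithinAt (fun σ => (γ σ).2.1)
        (-((t - s) * B (m (γ σ)))) (Set.Icc 0 1) σ := fun σ hσ => by
      simpa [W] using hasDerivWithinAt_fst_comp (hasDerivWithinAt_snd_comp (hder σ hσ))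
    have d3 : ∀ σ ∈ Set.Icc (0 : ℝ) 1, HasDerivWithinAt (fun σ => (γ σ).2.2.1)
        (-((t - s) * A (m (γ σ)))) (Set.Icc 0 1) σ := fun σ hσ => by
      simpa [W] using
        hasDerivWithinAt_fst_comp (hasDerivWithinAt_snd_comp (hasDerivWithinAt_snd_comp (hder σ hσ)))
    have d4 : ∀ σ ∈ Set.Icc (0 : ℝ) 1,
        HasDerivWithinAt (fun σ => (γ σ).2.2.2) 0 (Set.Icc 0 1) σ := fun σ hσ => by
      simpa [W] using
        hasDerivWithinAt_snd_comp (hasDerivWithinAt_snd_comp (hasDerivWithinAt_snd_comp (hder σ hσ)))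
    have e4 : (γ 1).2.2.2 = p := by
      rw [eq_of_hasDerivWithinAt_zero d4, hp0]
    have e1 : (γ 1).1 = t := by
      have := eq_of_hasDerivWithinAt_zero (f := fun σ => (γ σ).1 - σ * (t - s)) fun σ hσ => by
        refine ((d1 σ hσ).sub ((hasDerivWithinAt_id σ _).mul_const (t - s))).congr_deriv ?_
        ring
      simp only [hp0, one_mul, zero_mul, sub_zero] at this
      change (γ 1).1 - (t - s) = s at this
      linarith
    -- Conserved quantity: `λ' = -(t - s) B` moves the point along `(t - s) B X`, so `F` changes at
    -- rate `-(t - s) A F`, which the factor `e^(-μ)` compensates.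
    have hG := eq_of_hasDerivWithinAt_zero
      (f := fun σ => F (m (γ σ)) * Real.exp (-(γ σ).2.2.1)) fun σ hσ => by
        have hdm : HasDerivWithinAt (fun σ => m (γ σ))
            ((t - s) • (((1 : ℝ), (0 : Plane)) +
              B (m (γ σ)) • ((0 : ℝ), liouvilleField (m (γ σ)).2))) (Set.Icc 0 1) σ := by
          have := (d1 σ hσ).prodMk 
            (((hasDerivWithinAt_fst_comp (d4 σ hσ)).mul (d2 σ hσ).exp).prodMk
              (hasDerivWithinAt_snd_comp (d4 σ hσ)))
          refine this.congr_deriv ?_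
          ext <;> simp [m, liouvilleField]
          ring
        have hdF := ((hF.differentiable (by simp) (m (γ σ))).hasFDerivAt).comp_hasDerivWithinAt
          σ hdm
        refine (hdF.mul (d3 σ hσ).neg.exp).congr_deriv ?_
        have hz := (hp1 σ hσ).1.2
        simp only [map_smul, map_add, smul_eq_mul]
        rw [Function.comp_apply]
        linear_combination (t - s) * Real.exp (-(γ σ).2.2.1) * hz
    have hm1 : m (γ 1) = (t, axisMap (fun p => Real.exp (Γ (j ((s, t), p)) 1).2.1) 1 p) := by
      change ((γ 1).1, ((γ 1).2.2.2.1 * Real.exp (γ 1).2.1, (γ 1).2.2.2.2)) = _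
      rw [e1, e4]
      simp [axisMap, γ]
    have hm0' : m (γ 0) = (s, p) := by
      rw [hp0]
      simp [m, j]
    rw [hm1, hm0', hp0] at hG
    simp only [j, neg_zero, Real.exp_zero, mul_one] at hG
    rw [← hG, mul_comm]

/-- A perturbation `r` of `f` is removed by an axis-preserving contact equivalence if `r` and its
Lie derivative are small combinations of `f` and its Lie derivative. -/
theorem axisEquiv_sub {f r α₁ β₁ α₂ β₂ : Plane → ℝ} (hf : SmoothNear f) (hr : SmoothNear r)
    (hα₁ : SmoothNear α₁) (hβ₁ : SmoothNear β₁) (hα₂ : SmoothNear α₂) (hβ₂ : SmoothNear β₂)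
    (hα₁0 : α₁ 0 = 0) (hβ₁0 : β₁ 0 = 0) (hβ₂0 : β₂ 0 = 0)
    (h₁ : ∀ᶠ p in 𝓝 (0 : Plane), r p = α₁ p * f p + β₁ p * lieDerivative liouvilleField f p)
    (h₂ : ∀ᶠ p in 𝓝 (0 : Plane), lieDerivative liouvilleField r p =
      α₂ p * f p + β₂ p * lieDerivative liouvilleField f p) :
    AxisEquiv f (fun p => f p - r p) := by
  obtain ⟨f', hf', hff'⟩ := exists_contDiff_eventuallyEq hf
  obtain ⟨r', hr', hrr'⟩ := exists_contDiff_eventuallyEq hr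
  let F : ℝ × Plane → ℝ := fun q => f' q.2 - q.1 * r' q.2
  have hF : ContDiff ℝ ∞ F := by fun_prop
  -- With `F = (1 - t α₁) f - t β₁ X f` and `X F = -t α₂ f + (1 - t β₂) X f`, matching the
  -- coefficients of `f` and `X f` in `A F + B X F = r` is a linear system of determinant `Δ`; `A`
  -- and `B` come from Cramer's rule. At the origin `Δ = 1` for every `t`.
  let Δ : ℝ × Plane → ℝ := fun q =>
    (1 - q.1 * α₁ q.2) * (1 - q.1 * β₂ q.2) - q.1 ^ 2 * β₁ q.2 * α₂ q.2
  let A : ℝ × Plane → ℝ := fun q =>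
    (α₁ q.2 * (1 - q.1 * β₂ q.2) + q.1 * β₁ q.2 * α₂ q.2) * (Δ q)⁻¹
  let B : ℝ × Plane → ℝ := fun q => β₁ q.2 * (Δ q)⁻¹
  have key : ∀ t₀ : ℝ, ∀ᶠ st in 𝓝 (t₀, t₀),
      AxisEquiv (fun p => F (st.1, p)) (fun p => F (st.2, p)) := by
    intro t₀
    have hsnd : Tendsto (Prod.snd : ℝ × Plane → Plane) (𝓝 (t₀, 0)) (𝓝 0) :=
      continuous_snd.tendsto _
    have lift : ∀ {g : Plane → ℝ}, SmoothNear g →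
        ∀ᶠ q in 𝓝 (t₀, (0 : Plane)), ContDiffAt ℝ ∞ (fun q : ℝ × Plane => g q.2) q := by
      intro g hg
      filter_upwards [hsnd.eventually hg] with q hq
      exact hq.comp q contDiffAt_snd
    have hΔ : ∀ᶠ q in 𝓝 (t₀, (0 : Plane)), ContDiffAt ℝ ∞ Δ q := by
      filter_upwards [lift hα₁, lift hβ₁, lift hα₂, lift hβ₂] with q h1 h2 h3 h4
      exact ((contDiffAt_const.sub (contDiffAt_fst.mul h1)).mul
        (contDiffAt_const.sub (contDiffAt_fst.mul h4))).sub
        (((contDiffAt_fst.pow 2).mul h2).mul h3)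
    have hΔ0 : ∀ᶠ q in 𝓝 (t₀, (0 : Plane)), Δ q ≠ 0 := by
      refine hΔ.self_of_nhds.continuousAt.eventually_ne ?_
      simp [Δ, hα₁0, hβ₁0, hβ₂0]
    refine eventually_axisEquiv (A := A) (B := B) hF t₀ ?_ ?_ ?_
    · filter_upwards [lift hα₁, lift hβ₁, lift hα₂, lift hβ₂, hΔ, hΔ0] with q h1 h2 h3 h4 h5 h6
      exact ((h1.mul (contDiffAt_const.sub (contDiffAt_fst.mul h4))).add
        ((contDiffAt_fst.mul h2).mul h3)).mul (h5.inv h6)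
    · filter_upwards [lift hβ₁, hΔ, hΔ0] with q h1 h5 h6
      exact h1.mul (h5.inv h6)
    · filter_upwards [hΔ0, hsnd.eventually hff', hsnd.eventually hrr', hsnd.eventually h₁,
        hsnd.eventually h₂, hsnd.eventually (lieDerivative_congr liouvilleField hff'),
        hsnd.eventually (lieDerivative_congr liouvilleField hrr')] with q h0 e1 e2 e3 e4 e5 e6
      have hd1 : HasFDerivAt (fun q : ℝ × Plane => f' q.2) _ q :=
        ((hf'.differentiable (by simp) q.2).hasFDerivAt).comp q hasFDerivAt_snd
      have hd2 : HasFDerivAt (fun q : ℝ × Plane => r' q.2) _ q :=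
        ((hr'.differentiable (by simp) q.2).hasFDerivAt).comp q hasFDerivAt_snd
      have hd : HasFDerivAt F _ q := hd1.sub (hasFDerivAt_fst.mul hd2)
      have v1 : fderiv ℝ F q (1, 0) = -r q.2 := by
        rw [hd.fderiv, ← e2]
        simp
      have v2 : fderiv ℝ F q (0, liouvilleField q.2) =
          lieDerivative liouvilleField f q.2 - q.1 * lieDerivative liouvilleField r q.2 := by
        rw [hd.fderiv, ← e5, ← e6]
        simp [lieDerivative]
      rw [v1, v2]
      simp only [F, e1, e2, e3, e4]
      have hΔm : Δ q * (Δ q)⁻¹ = 1 := mul_inv_cancel₀ h0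
      simp only [A, B]
      generalize (Δ q)⁻¹ = d at hΔm ⊢
      simp only [Δ] at hΔm
      linear_combination (α₁ q.2 * f q.2 + β₁ q.2 * lieDerivative liouvilleField f q.2) * hΔm
  have hconn : AxisEquiv (fun p => F (0, p)) (fun p => F (1, p)) := by
    -- Both directions of the equivalence are known near each `t₀`, so transitivity and
    -- connectedness of `ℝ` suffice.
    refine PreconnectedSpace.induction₂'
      (fun s t : ℝ => AxisEquiv (fun p => F (s, p)) (fun p => F (t, p))) (fun t₀ => ?_)
      ⟨fun _ _ _ => AxisEquiv.trans⟩ 0 1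
    have c1 : Tendsto (fun t : ℝ => (t₀, t)) (𝓝 t₀) (𝓝 (t₀, t₀)) :=
      (Continuous.prodMk_right t₀).tendsto t₀
    have c2 : Tendsto (fun t : ℝ => (t, t₀)) (𝓝 t₀) (𝓝 (t₀, t₀)) :=
      (Continuous.prodMk_left t₀).tendsto t₀
    exact (c1.eventually (key t₀)).and (c2.eventually (key t₀))
  refine hconn.congr ?_ ?_
  · filter_upwards [hff'] with p hp
    simp [F, hp]
  · filter_upwards [hff', hrr'] with p h1 h2
    simp [F, h1, h2]

/-- Finite determinacy: a function of codimension `k` is equivalent to its `k`-jet. -/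
theorem axisEquiv_jet {f : Plane → ℝ} (hf : SmoothNear f) {k : ℕ}
    (hk : codim liouvilleField smoothNear_liouvilleField f hf = k) : AxisEquiv f (jet k f) := by
  -- From `m^k ⊆ I` follows `m^(k+1) ⊆ m I`: the extra order of the Taylor remainder puts the
  -- coefficients in `m`.
  have hpow := Ideal.pow_le_of_rank_quotient_eq ker_evalGerm_le_jacobson hk
  have split : ∀ {r : Plane → ℝ}, VanishesToOrder (k + 1) r →
      ∃ α β : Plane → ℝ, SmoothNear α ∧ SmoothNear β ∧ α 0 = 0 ∧ β 0 = 0 ∧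
        ∀ᶠ p in 𝓝 (0 : Plane), r p = α p * f p + β p * lieDerivative liouvilleField f p := by
    intro r hr
    have hmem := hr.functionGerm_mem
    rw [pow_succ'] at hmem
    obtain ⟨a, ha, b, hb, hab⟩ := exists_of_mem_mul_span_pair (Ideal.mul_mono_right hpow hmem)
    obtain ⟨α, hα, rfl⟩ := exists_functionGerm_eq a
    obtain ⟨β, hβ, rfl⟩ := exists_functionGerm_eq b
    exact ⟨α, β, hα, hβ, ha, hb, (functionGerm_eq_iff _ ((hα.mul hf).add
      (hβ.mul (smoothNear_liouvilleField.lieDerivative hf)))).1 hab⟩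
  have hr := hf.vanishesToOrder_sub_jet k
  obtain ⟨α₁, β₁, hα₁, hβ₁, hα₁0, hβ₁0, h₁⟩ := split hr
  obtain ⟨α₂, β₂, hα₂, hβ₂, -, hβ₂0, h₂⟩ := split hr.lieDerivative
  refine (axisEquiv_sub hf hr.smoothNear hα₁ hβ₁ hα₂ hβ₂ hα₁0 hβ₁0 hβ₂0 h₁ h₂).congr
    (EventuallyEq.refl _ _) (Eventually.of_forall fun p => ?_)
  simp

end ContactEquivalence

/-! ### Computing codimensions zero and one. -/

section Codimension

theorem evalGerm_lieDerivative_liouvilleField {f : Plane → ℝ} (hf : SmoothNear f) :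
    evalGerm (functionGerm _ (smoothNear_liouvilleField.lieDerivative hf)) = 0 := by
  have h : liouvilleField 0 = 0 := by simp [liouvilleField]
  change fderiv ℝ f 0 (liouvilleField 0) = 0
  rw [h, map_zero]

theorem codim_eq_zero {f : Plane → ℝ} (hf : SmoothNear f) (h0 : f 0 ≠ 0) :
    codim liouvilleField smoothNear_liouvilleField f hf = 0 := by
  have htop : tangentIdeal liouvilleField smoothNear_liouvilleField f hf = ⊤ :=
    Ideal.eq_top_of_isUnit_mem _ (Ideal.subset_span (Set.mem_insert _ _))
      (isUnit_of_evalGerm_ne_zero (z := functionGerm f hf) h0)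
  have : Subsingleton (FunctionGerm ⧸
      tangentIdeal liouvilleField smoothNear_liouvilleField f hf) :=
    Ideal.Quotient.subsingleton_iff.2 htop
  exact rank_subsingleton' ..

theorem rank_quotient_ker_evalGerm :
    Module.rank ℝ (FunctionGerm ⧸ RingHom.ker evalGerm) = 1 := by
  rw [(Ideal.quotientKerAlgEquivOfSurjective evalGerm_surjective).toLinearEquiv.rank_eq,
    Module.rank_self]

theorem tangentIdeal_le_ker_evalGerm {f : Plane → ℝ} (hf : SmoothNear f) (h0 : f 0 = 0) :
    tangentIdeal liouvilleField smoothNear_liouvilleField f hf ≤ RingHom.ker evalGerm := by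
  rw [tangentIdeal, Ideal.span_le]
  rintro z (rfl | rfl)
  · exact RingHom.mem_ker.2 h0
  · exact RingHom.mem_ker.2 (evalGerm_lieDerivative_liouvilleField hf)

theorem SmoothNear.exists_eq_add_mul {f : Plane → ℝ} (hf : SmoothNear f) (h0 : f 0 = 0) :
    ∃ a b : Plane → ℝ, SmoothNear a ∧ SmoothNear b ∧
      f =ᶠ[𝓝 0] fun p => p.1 * a p + p.2 * b p := by
  obtain ⟨a, b, ha, hb, h⟩ := hf.vanishesToOrder_sub_jet 0
  refine ⟨a, b, ha, hb, ?_⟩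
  filter_upwards [h] with p hp
  rw [← hp]
  simp [jet, h0]

theorem smoothNear_fderiv_apply {f : Plane → ℝ} (hf : SmoothNear f) (v : Plane) :
    SmoothNear (fun p => fderiv ℝ f p v) :=
  SmoothNear.lieDerivative (X := fun _ => v) contDiff_const.smoothNear hf

/-- The ideal is all of `m`: `X f = -x ∂₁f` with `∂₁f` a unit gives `x`, and then `f = x a + y b`
with `b(0) = ∂₂f(0) ≠ 0` gives `y`. -/
theorem codim_eq_one {f : Plane → ℝ} (hf : SmoothNear f) (h0 : f 0 = 0)
    (hx : fderiv ℝ f 0 (1, 0) ≠ 0) (hy : fderiv ℝ f 0 (0, 1) ≠ 0) :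
    codim liouvilleField smoothNear_liouvilleField f hf = 1 := by
  suffices h : tangentIdeal liouvilleField smoothNear_liouvilleField f hf =
      RingHom.ker evalGerm by
    rw [codim, h, rank_quotient_ker_evalGerm]
  refine (tangentIdeal_le_ker_evalGerm hf h0).antisymm ?_
  set I := tangentIdeal liouvilleField smoothNear_liouvilleField f hf
  have hfI : functionGerm f hf ∈ I := Ideal.subset_span (Set.mem_insert _ _)
  have hdI : functionGerm _ (smoothNear_liouvilleField.lieDerivative hf) ∈ I :=
    Ideal.subset_span (Set.mem_insert_of_mem _ rfl)
  have hX : functionGerm _ smoothNear_fst ∈ I := by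
    have hs := smoothNear_fderiv_apply hf (1, 0)
    have hu : IsUnit (functionGerm _ hs) := isUnit_of_evalGerm_ne_zero hx
    rw [← I.mul_unit_mem_iff_mem hu, ← neg_mem_iff]
    convert hdI using 1
    rw [neg_eq_iff_add_eq_zero]
    refine (functionGerm_eq_iff _ (smoothNear_const 0)).2 (Eventually.of_forall fun p => ?_)
    have : liouvilleField p = (-p.1) • ((1 : ℝ), (0 : ℝ)) := by simp [liouvilleField]
    change p.1 * fderiv ℝ f p (1, 0) + fderiv ℝ f p (liouvilleField p) = 0
    rw [this, map_smul, smul_eq_mul]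
    ring
  obtain ⟨a, b, ha, hb, hab⟩ := hf.exists_eq_add_mul h0
  have hY : functionGerm _ smoothNear_snd ∈ I := by
    have hb0 : fderiv ℝ f 0 (0, 1) = b 0 := by
      have hd := (hasFDerivAt_fst.mul ha.eventually_differentiableAt.self_of_nhds.hasFDerivAt).add
        (hasFDerivAt_snd.mul hb.eventually_differentiableAt.self_of_nhds.hasFDerivAt)
      rw [hab.fderiv_eq]
      refine (congrArg (fun L : Plane →L[ℝ] ℝ => L (0, 1)) hd.fderiv).trans ?_
      simp
    have hu : IsUnit (functionGerm b hb) := isUnit_of_evalGerm_ne_zero (by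
      rw [evalGerm_functionGerm, ← hb0]
      exact hy)
    have : functionGerm _ smoothNear_snd * functionGerm b hb =
        functionGerm f hf - functionGerm _ smoothNear_fst * functionGerm a ha := by
      rw [eq_sub_iff_add_eq']
      exact ((functionGerm_eq_iff hf ((smoothNear_fst.mul ha).add (smoothNear_snd.mul hb))).2
        hab).symm
    rw [← I.mul_unit_mem_iff_mem hu, this]
    exact I.sub_mem hfI (I.mul_mem_right _ hX)
  intro z hz
  obtain ⟨g, hg, rfl⟩ := exists_functionGerm_eq z
  obtain ⟨a, b, ha, hb, hab⟩ := hg.exists_eq_add_mul hz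
  rw [(functionGerm_eq_iff hg ((smoothNear_fst.mul ha).add (smoothNear_snd.mul hb))).2 hab]
  exact I.add_mem (I.mul_mem_right (functionGerm a ha) hX) (I.mul_mem_right (functionGerm b hb) hY)

/-- Codimension one forces `m ⊆ I`, so `x` and `y` lie in `I`. Linear parts of elements of `I` have
the form `α df - β ∂₁f dx` at the origin; obtaining `dx` requires `∂₁f ≠ 0`, and obtaining `dy`
requires `∂₂f ≠ 0`. -/
theorem of_codim_eq_one {f : Plane → ℝ} (hf : SmoothNear f)
    (h : codim liouvilleField smoothNear_liouvilleField f hf = 1) :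
    f 0 = 0 ∧ fderiv ℝ f 0 (1, 0) ≠ 0 ∧ fderiv ℝ f 0 (0, 1) ≠ 0 := by
  have h0 : f 0 = 0 := by
    by_contra hne
    rw [codim_eq_zero hf hne] at h
    exact zero_ne_one h
  have hle : RingHom.ker evalGerm ≤ tangentIdeal liouvilleField smoothNear_liouvilleField f hf := by
    have := Ideal.pow_le_of_rank_quotient_eq (K := ℝ) (k := 1) ker_evalGerm_le_jacobson
      (h.trans Nat.cast_one.symm)
    rwa [pow_one] at this
  have key : ∀ {g : Plane → ℝ} (hg : SmoothNear g), g 0 = 0 → ∃ α β : ℝ, ∀ v : Plane,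
      fderiv ℝ g 0 v = α * fderiv ℝ f 0 v - β * (v.1 * fderiv ℝ f 0 (1, 0)) := by
    intro g hg hg0
    obtain ⟨a, b, hab⟩ := Ideal.mem_span_pair.1
      (hle (show functionGerm g hg ∈ RingHom.ker evalGerm from hg0))
    obtain ⟨α, hα, rfl⟩ := exists_functionGerm_eq a
    obtain ⟨β, hβ, rfl⟩ := exists_functionGerm_eq b
    have hs := smoothNear_fderiv_apply hf (1, 0)
    have heq : (fun p => α p * f p + β p * lieDerivative liouvilleField f p) =ᶠ[𝓝 0] g :=
      (functionGerm_eq_iff ((hα.mul hf).add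
        (hβ.mul (smoothNear_liouvilleField.lieDerivative hf))) hg).1 hab
    have heq' : g =ᶠ[𝓝 0] fun p => α p * f p - β p * (p.1 * fderiv ℝ f p (1, 0)) := by
      filter_upwards [heq] with p hp
      have : liouvilleField p = (-p.1) • ((1 : ℝ), (0 : ℝ)) := by simp [liouvilleField]
      rw [← hp]
      simp only [lieDerivative, this, map_smul, smul_eq_mul]
      ring
    refine ⟨α 0, β 0, fun v => ?_⟩
    have d1 := hα.eventually_differentiableAt.self_of_nhds.hasFDerivAt
    have d2 := hβ.eventually_differentiableAt.self_of_nhds.hasFDerivAt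
    have d3 := hf.eventually_differentiableAt.self_of_nhds.hasFDerivAt
    have d4 := hs.eventually_differentiableAt.self_of_nhds.hasFDerivAt
    have hd := (d1.mul d3).sub (d2.mul (hasFDerivAt_fst.mul d4))
    rw [heq'.fderiv_eq]
    refine (congrArg (fun L : Plane →L[ℝ] ℝ => L v) hd.fderiv).trans ?_
    simp [h0]
    left
    ring
  obtain ⟨α, β, h1⟩ := key smoothNear_fst rfl
  obtain ⟨α', β', h2⟩ := key smoothNear_snd rfl
  have e1 := h1 (1, 0)
  have e2 := h2 (0, 1)
  have hfst : fderiv ℝ (fun p : Plane => p.1) 0 = ContinuousLinearMap.fst ℝ ℝ ℝ := fderiv_fst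
  have hsnd : fderiv ℝ (fun p : Plane => p.2) 0 = ContinuousLinearMap.snd ℝ ℝ ℝ := fderiv_snd
  rw [hfst] at e1
  rw [hsnd] at e2
  refine ⟨h0, fun hz => ?_, fun hz => ?_⟩
  · simp [hz] at e1
  · simp [hz] at e2

theorem fderiv_apply_ne_zero_of_transversalTo {f : Plane → ℝ} {v : Plane}
    (hf : fderiv ℝ f 0 ≠ 0) (h : TransversalTo f v) : fderiv ℝ f 0 v ≠ 0 := by
  intro hv
  refine hf (ContinuousLinearMap.coe_injective (LinearMap.ker_eq_top.1 ?_))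
  rw [TransversalTo, sup_eq_left.2] at h
  · exact h
  · rw [Submodule.span_le, Set.singleton_subset_iff]
    exact hv

end Codimension

/-! ### Conformal symmetries of the Liouville form and conjugacy of fields. -/

section Conjugacy

theorem isInvertible_eventually {φ : Plane → Plane} (hφ : SmoothNear φ)
    (h : (fderiv ℝ φ 0).IsInvertible) : ∀ᶠ p in 𝓝 (0 : Plane), (fderiv ℝ φ p).IsInvertible := by
  have hc : ContinuousAt (fderiv ℝ φ) 0 :=
    (hφ.self_of_nhds.fderiv_right (m := ∞) (by simp)).continuousAt
  obtain ⟨e, he⟩ := h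
  have := ContinuousLinearEquiv.nhds e
  rw [he] at this
  exact hc.eventually this

theorem SmoothNear.isDiffeoGerm {φ : Plane → Plane} (hφ : SmoothNear φ) (h0 : φ 0 = 0)
    (h : (fderiv ℝ φ 0).IsInvertible) : IsDiffeoGerm φ := by
  obtain ⟨e, he⟩ := h
  have hd : HasFDerivAt φ (e : Plane →L[ℝ] Plane) 0 :=
    he ▸ hφ.eventually_differentiableAt.self_of_nhds.hasFDerivAt
  obtain ⟨Φ, hmem, hΦ, hs, hs'⟩ := exists_openPartialHomeomorph_contDiffOn hφ hd
  refine ⟨h0, ⟨⟨Φ.toPartialEquiv, Φ.open_source, Φ.open_target, ?_, ?_⟩, hmem, ?_⟩⟩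
  · exact (hΦ ▸ hs : ContDiffOn ℝ ∞ Φ Φ.source).contMDiffOn
  · exact hs'.contMDiffOn
  · intro p _
    exact congrFun hΦ.symm p

theorem IsDiffeoGerm.smoothNear {φ : Plane → Plane} (hφ : IsDiffeoGerm φ) : SmoothNear φ := by
  obtain ⟨-, Φ, hmem, hΦ⟩ := hφ
  filter_upwards [Φ.open_source.mem_nhds hmem] with p hp
  have h1 : ContDiffAt ℝ ∞ Φ p :=
    (Φ.contMDiffOn_toFun.contDiffOn).contDiffAt (Φ.open_source.mem_nhds hp)
  exact h1.congr_of_eventuallyEq (hΦ.eventuallyEq_of_mem (Φ.open_source.mem_nhds hp))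

theorem IsDiffeoGerm.isInvertible_fderiv {φ : Plane → Plane} (hφ : IsDiffeoGerm φ) :
    (fderiv ℝ φ 0).IsInvertible := by
  have h := hφ.2
  exact ⟨h.mfderivToContinuousLinearEquiv (by simp),
    (h.mfderivToContinuousLinearEquiv_coe (by simp)).trans mfderiv_eq_fderiv⟩

theorem fderiv_axisMap {u : Plane → ℝ} {p : Plane} (hu : DifferentiableAt ℝ u p) (c : ℝ)
    (v : Plane) :
    fderiv ℝ (axisMap u c) p v = (p.1 * fderiv ℝ u p v + u p * v.1, c * v.2) := by
  have h := (hasFDerivAt_fst.mul hu.hasFDerivAt).prodMk (hasFDerivAt_snd.const_mul c)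
  refine (congrArg (fun L : Plane →L[ℝ] Plane => L v) h.fderiv).trans ?_
  simp

theorem isInvertible_fderiv_axisMap {u : Plane → ℝ} (hu : IsUnitGerm u) {c : ℝ} (hc : c ≠ 0) :
    (fderiv ℝ (axisMap u c) 0).IsInvertible := by
  refine ⟨(ContinuousLinearEquiv.unitsEquivAut ℝ (Units.mk0 _ hu.2)).prodCongr
    (ContinuousLinearEquiv.unitsEquivAut ℝ (Units.mk0 _ hc)), ?_⟩
  refine ContinuousLinearMap.ext fun v => ?_
  rw [fderiv_axisMap hu.1.eventually_differentiableAt.self_of_nhds]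
  ext <;> simp [mul_comm]

/-- Equivalence of functions by an axis map gives conjugacy of the multiples of the field. -/
theorem orbitallyConj_of_eq_mul_comp_axisMap {f g u h : Plane → ℝ} {c : ℝ} (hc : c ≠ 0)
    (hu : IsUnitGerm u) (hh : IsUnitGerm h)
    (hfg : ∀ᶠ p in 𝓝 (0 : Plane), f p = h p * g (axisMap u c p)) :
    OrbitallyConj liouvilleForm (fun p => f p • liouvilleField p)
      (fun p => g p • liouvilleField p) := by
  have hφ := hu.1.axisMap c
  have hinv := isInvertible_fderiv_axisMap hu hc
  have hdiff := hu.1.eventually_differentiableAt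
  have hu0 : ∀ᶠ p in 𝓝 (0 : Plane), u p ≠ 0 :=
    hu.1.self_of_nhds.continuousAt.eventually_ne hu.2
  -- This is `∂₁(x u)`. The form pulls back to `c x u dy`, which dictates `k = 1/(c u)`; the field
  -- `g X` pulls back to `(u/d) (g ∘ φ) X`, which dictates the factor `d/u`.
  let d : Plane → ℝ := fun p => u p + p.1 * fderiv ℝ u p (1, 0)
  have hd : SmoothNear d := hu.1.add (smoothNear_fst.mul (smoothNear_fderiv_apply hu.1 (1, 0)))
  have hd00 : d 0 ≠ 0 := by simpa [d] using hu.2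
  have hd0 : ∀ᶠ p in 𝓝 (0 : Plane), d p ≠ 0 := hd.self_of_nhds.continuousAt.eventually_ne hd00
  refine ⟨axisMap u c, ⟨hφ.isDiffeoGerm (axisMap_zero u c) hinv, fun p => (c * u p)⁻¹,
    ⟨((smoothNear_const c).mul hu.1).inv (mul_ne_zero hc hu.2),
      inv_ne_zero (mul_ne_zero hc hu.2)⟩, ?_⟩, fun p => h p * (d p * (u p)⁻¹),
    ⟨hh.1.mul (hd.mul (hu.1.inv hu.2)), mul_ne_zero hh.2 (mul_ne_zero hd00 (inv_ne_zero hu.2))⟩,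
    ?_⟩
  · filter_upwards [hdiff, hu0] with p h1 h2
    refine ContinuousLinearMap.ext fun v => ?_
    simp only [pullbackForm, liouvilleForm, ContinuousLinearMap.comp_apply, smul_apply,
      ContinuousLinearMap.coe_snd', smul_eq_mul, fderiv_axisMap h1]
    simp only [axisMap]
    field_simp
  · filter_upwards [hfg, hdiff, hu0, hd0, isInvertible_eventually hφ hinv] with p h1 h2 h3 h4 h5
    have hpull : VectorField.pullback ℝ (axisMap u c) (fun p => g p • liouvilleField p) p =
        (-(p.1 * u p * g (axisMap u c p) * (d p)⁻¹)) • ((1 : ℝ), (0 : ℝ)) := by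
      rw [VectorField.pullback, h5.inverse_apply_eq, map_smul, fderiv_axisMap h2]
      ext
      · simp only [liouvilleField, axisMap, Prod.smul_mk, smul_eq_mul, mul_one]
        have : p.1 * fderiv ℝ u p (1, 0) + u p = d p := add_comm _ _
        rw [this]
        field_simp
      · simp [liouvilleField]
    rw [hpull, h1]
    ext
    · simp only [liouvilleField, Prod.smul_mk, smul_eq_mul, mul_one]
      field_simp
    · simp [liouvilleField]

/-- The fields conjugate to `c X`, for the field `X` of the Liouville form, and the linear part of
the conjugating diffeomorphism. -/
theorem OrbitallyConj.exists_eq_smul {Y : Plane → Plane} {c : Plane → ℝ}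
    (h : OrbitallyConj liouvilleForm Y (fun p => c p • liouvilleField p)) :
    ∃ (φ : Plane → Plane) (s : Plane → ℝ), SmoothNear φ ∧ φ 0 = 0 ∧ IsUnitGerm s ∧
      (Y =ᶠ[𝓝 0] fun p => (s p * c (φ p)) • liouvilleField p) ∧
      (fderiv ℝ φ 0 (1, 0)).1 ≠ 0 ∧ (fderiv ℝ φ 0 (1, 0)).2 = 0 ∧
      (fderiv ℝ φ 0 (0, 1)).1 = 0 ∧ (fderiv ℝ φ 0 (0, 1)).2 ≠ 0 := by
  obtain ⟨φ, ⟨hdiffeo, k, hk, hform⟩, h, hh, hY⟩ := h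
  have hφ := hdiffeo.smoothNear
  have h0 := hdiffeo.1
  have hinv0 := hdiffeo.isInvertible_fderiv
  have hinv := isInvertible_eventually hφ hinv0
  have hk0 : ∀ᶠ p in 𝓝 (0 : Plane), k p ≠ 0 :=
    hk.1.self_of_nhds.continuousAt.eventually_ne hk.2
  have hφ1 : SmoothNear fun p => (φ p).1 := by
    filter_upwards [hφ] with p hp using contDiffAt_fst.comp p hp
  have hform' : ∀ᶠ p in 𝓝 (0 : Plane), ∀ v : Plane,
      p.1 * v.2 = k p * ((φ p).1 * (fderiv ℝ φ p v).2) := by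
    filter_upwards [hform] with p hp v
    simpa [pullbackForm, liouvilleForm] using congrArg (fun L : Plane →L[ℝ] ℝ => L v) hp
  -- On the axis the left side of `hform'` vanishes; testing on the preimage of `(0, 1)` under the
  -- derivative isolates the first component of `φ`.
  have haxis : ∀ᶠ p in 𝓝 (0 : Plane), p.1 = 0 → (φ p).1 = 0 := by
    filter_upwards [hform', hk0, hinv] with p h1 h2 h3 hp
    obtain ⟨e, he⟩ := h3
    have := h1 (e.symm (0, 1))
    rw [← he, hp] at this
    simpa [h2] using this
  -- Off the axis, `v = (0, 1)` shows that the first component of `φ` is nonzero, and then `v = (1,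
  -- 0)` gives the claim.
  have hoff : ∀ᶠ p in 𝓝 (0 : Plane), p.1 ≠ 0 → (fderiv ℝ φ p (1, 0)).2 = 0 := by
    filter_upwards [hform', hk0] with p h1 h2 hp
    have e1 := h1 (1, 0)
    have e2 := h1 (0, 1)
    have hne : (φ p).1 ≠ 0 := by
      intro hz
      simp [hz, hp] at e2
    simpa [h2, hne] using e1
  obtain ⟨u, hu, hφu⟩ : ∃ u : Plane → ℝ, SmoothNear u ∧
      ∀ᶠ p in 𝓝 (0 : Plane), (φ p).1 = p.1 * u p := by
    obtain ⟨g, hg, hgφ⟩ := exists_contDiff_eventuallyEq hφ1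
    obtain ⟨u, hu, hgu⟩ := exists_contDiff_eq_add_fst_mul hg
    refine ⟨u, hu.smoothNear, ?_⟩
    have ht : Tendsto (fun p : Plane => ((0 : ℝ), p.2)) (𝓝 0) (𝓝 0) := by
      have : Continuous fun p : Plane => ((0 : ℝ), p.2) := by fun_prop
      exact this.tendsto 0
    filter_upwards [hgφ, ht.eventually hgφ, ht.eventually haxis] with p h1 h2 h3
    rw [← h1, hgu p, h2, h3 rfl, zero_add]
  have hd1 : ∀ᶠ p in 𝓝 (0 : Plane), ∀ v : Plane,
      (fderiv ℝ φ p v).1 = p.1 * fderiv ℝ u p v + u p * v.1 := by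
    have hφu' : (fun p => (φ p).1) =ᶠ[𝓝 0] fun p => p.1 * u p := hφu
    filter_upwards [hφu'.eventuallyEq_nhds, hφ.eventually_differentiableAt,
      hu.eventually_differentiableAt] with p h1 h2 h3 v
    have e1 : fderiv ℝ (fun p => (φ p).1) p v = (fderiv ℝ φ p v).1 := by
      have := (hasFDerivAt_fst (𝕜 := ℝ) (p := φ p)).comp p h2.hasFDerivAt
      exact congrArg (fun L : Plane →L[ℝ] ℝ => L v) this.fderiv
    have e2 := hasFDerivAt_fst.mul h3.hasFDerivAt
    rw [← e1, h1.fderiv_eq]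
    refine (congrArg (fun L : Plane →L[ℝ] ℝ => L v) e2.fderiv).trans ?_
    simp
  -- The origin lies on the axis, so the value is a limit along the points `(t, 0)` with `t ≠ 0`.
  have hx2 : (fderiv ℝ φ 0 (1, 0)).2 = 0 := by
    have hcont : ContinuousAt (fun p => (fderiv ℝ φ p (1, 0)).2) (0 : Plane) :=
      continuousAt_snd.comp
        ((hφ.self_of_nhds.fderiv_right (m := ∞) (by simp)).continuousAt.clm_apply
          continuousAt_const)
    have hline : Tendsto (fun t : ℝ => ((t, 0) : Plane)) (𝓝 0) (𝓝 0) := by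
      have : Continuous fun t : ℝ => ((t, 0) : Plane) := by fun_prop
      exact this.tendsto 0
    have h1 : Tendsto (fun t : ℝ => (fderiv ℝ φ (t, 0) (1, 0)).2) (𝓝[≠] 0)
        (𝓝 (fderiv ℝ φ 0 (1, 0)).2) :=
      (hcont.tendsto.comp hline).mono_left nhdsWithin_le_nhds
    have h2 : ∀ᶠ t in 𝓝[≠] (0 : ℝ), (fderiv ℝ φ (t, 0) (1, 0)).2 = 0 := by
      filter_upwards [(hline.mono_left nhdsWithin_le_nhds).eventually hoff,
        self_mem_nhdsWithin] with t h3 h4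
      exact h3 h4
    exact tendsto_nhds_unique (h1.congr' h2) tendsto_const_nhds
  have hx1 : (fderiv ℝ φ 0 (1, 0)).1 = u 0 := by
    rw [hd1.self_of_nhds]
    simp
  have hy1 : (fderiv ℝ φ 0 (0, 1)).1 = 0 := by
    rw [hd1.self_of_nhds]
    simp
  obtain ⟨e, he⟩ := hinv0
  have hinj : ∀ v, fderiv ℝ φ 0 v = 0 → v = 0 := by
    intro v hv
    rw [← he] at hv
    exact e.map_eq_zero_iff.1 hv
  have hu0 : u 0 ≠ 0 := by
    intro hz
    have := hinj (1, 0) (Prod.ext (hx1.trans hz) hx2)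
    simp at this
  have hy2 : (fderiv ℝ φ 0 (0, 1)).2 ≠ 0 := by
    intro hz
    have := hinj (0, 1) (Prod.ext hy1 hz)
    simp at this
  let d : Plane → ℝ := fun p => u p + p.1 * fderiv ℝ u p (1, 0)
  have hd : SmoothNear d := hu.add (smoothNear_fst.mul (smoothNear_fderiv_apply hu (1, 0)))
  have hd00 : d 0 ≠ 0 := by simpa [d] using hu0
  have hd0 : ∀ᶠ p in 𝓝 (0 : Plane), d p ≠ 0 := hd.self_of_nhds.continuousAt.eventually_ne hd00
  refine ⟨φ, fun p => h p * (u p * (d p)⁻¹), hφ, h0,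
    ⟨hh.1.mul (hu.mul (hd.inv hd00)), mul_ne_zero hh.2 (mul_ne_zero hu0 (inv_ne_zero hd00))⟩,
    ?_, hx1 ▸ hu0, hx2, hy1, hy2⟩
  filter_upwards [hY, hinv, hd0, hd1, hφu, hoff] with p e1 e2 e3 e4 e5 e6
  have hpull : VectorField.pullback ℝ φ (fun p => c p • liouvilleField p) p =
      (-(p.1 * u p * c (φ p) * (d p)⁻¹)) • ((1 : ℝ), (0 : ℝ)) := by
    rw [VectorField.pullback, e2.inverse_apply_eq, map_smul]
    -- On the axis both sides vanish, so the derivative of `φ` is not needed there.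
    by_cases hp : p.1 = 0
    · simp [liouvilleField, e5, hp]
    · have e7 : (fderiv ℝ φ p (1, 0)).1 = d p := by
        rw [e4]
        simp only [d]
        ring
      ext
      · simp only [liouvilleField, e5, Prod.smul_fst, smul_eq_mul, e7]
        field_simp
      · simp [liouvilleField, e6 hp]
  rw [e1, hpull]
  ext
  · simp only [liouvilleField, Prod.smul_mk, smul_eq_mul, mul_one]
    ring
  · simp [liouvilleField]

end Conjugacy

/-! ### Normal forms and uniqueness of the classes. -/

section Classification

theorem OrbitallyConj.congr_left {a : Plane → Plane →L[ℝ] ℝ} {X₁ X₁' X₂ : Plane → Plane}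
    (h : OrbitallyConj a X₁ X₂) (hX : X₁ =ᶠ[𝓝 0] X₁') : OrbitallyConj a X₁' X₂ := by
  obtain ⟨φ, hφ, k, hk, heq⟩ := h
  exact ⟨φ, hφ, k, hk, hX.symm.trans heq⟩

theorem orbitallyConj_of_ne_zero {f : Plane → ℝ} (hf : SmoothNear f) (h0 : f 0 ≠ 0) :
    OrbitallyConj liouvilleForm (fun p => f p • liouvilleField p) liouvilleField := by
  have := orbitallyConj_of_eq_mul_comp_axisMap (g := fun _ => 1) (f := f) one_ne_zero
    (u := fun _ => 1) ⟨smoothNear_const 1, one_ne_zero⟩ ⟨hf, h0⟩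
    (Eventually.of_forall fun p => (mul_one _).symm)
  simpa only [one_smul] using this

theorem AxisEquiv.orbitallyConj {f g : Plane → ℝ} (h : AxisEquiv f g) :
    OrbitallyConj liouvilleForm (fun p => f p • liouvilleField p)
      (fun p => g p • liouvilleField p) := by
  obtain ⟨u, k, hu, hk, hfg⟩ := h
  exact orbitallyConj_of_eq_mul_comp_axisMap one_ne_zero hu hk hfg

theorem jet_one_apply {f : Plane → ℝ} (h0 : f 0 = 0) (p : Plane) :
    jet 1 f p = fderiv ℝ f 0 (1, 0) * p.1 + fderiv ℝ f 0 (0, 1) * p.2 := by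
  have hp : p = p.1 • ((1 : ℝ), (0 : ℝ)) + p.2 • ((0 : ℝ), (1 : ℝ)) := by simp
  have : jet 1 f p = fderiv ℝ f 0 p := by
    simp [jet, Finset.sum_range_succ, h0]
  rw [this]
  conv_lhs => rw [hp, map_add, map_smul, map_smul, smul_eq_mul, smul_eq_mul]
  ring

/-- By determinacy `f` reduces to `a x + b y` with `a, b ≠ 0`; the axis map absorbs `a` into `u` and
takes `c = b`. -/
theorem orbitallyConj_add_of_codim_eq_one {f : Plane → ℝ} (hf : SmoothNear f)
    (h : codim liouvilleField smoothNear_liouvilleField f hf = 1) :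
    OrbitallyConj liouvilleForm (fun p => f p • liouvilleField p)
      (fun p => (p.1 + p.2) • liouvilleField p) := by
  obtain ⟨h0, hx, hy⟩ := of_codim_eq_one hf h
  obtain ⟨u, k, hu, hk, hfg⟩ := axisEquiv_jet (k := 1) hf (h.trans Nat.cast_one.symm)
  refine orbitallyConj_of_eq_mul_comp_axisMap (g := fun p => p.1 + p.2) hy
    (u := fun p => fderiv ℝ f 0 (1, 0) * u p)
    ⟨(smoothNear_const _).mul hu.1, mul_ne_zero hx hu.2⟩ hk ?_
  filter_upwards [hfg] with p hp
  rw [hp, jet_one_apply h0]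
  simp only [axisMap]
  ring

theorem hasCodim_zero_of_orbitallyConj {Y : Plane → Plane}
    (h : OrbitallyConj liouvilleForm Y liouvilleField) :
    HasCodim liouvilleField smoothNear_liouvilleField Y 0 := by
  have h' : OrbitallyConj liouvilleForm Y (fun p => (1 : ℝ) • liouvilleField p) := by
    simpa only [one_smul] using h
  obtain ⟨φ, s, -, -, hs, hY, -⟩ := h'.exists_eq_smul (c := fun _ => 1)
  refine ⟨s, hs.1, ?_, codim_eq_zero hs.1 hs.2⟩
  simpa only [mul_one] using hY

/-- The coefficient of `Y` is `s · (φ₁ + φ₂)`. As the linear part of `φ` is diagonal and invertible,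
both partial derivatives of this coefficient at the origin are nonzero. -/
theorem hasCodim_one_of_orbitallyConj {Y : Plane → Plane}
    (h : OrbitallyConj liouvilleForm Y (fun p => (p.1 + p.2) • liouvilleField p)) :
    HasCodim liouvilleField smoothNear_liouvilleField Y 1 := by
  obtain ⟨φ, s, hφ, h0, hs, hY, hx1, hx2, hy1, hy2⟩ :=
    h.exists_eq_smul (c := fun p => p.1 + p.2)
  have hsm : SmoothNear fun p => s p * ((φ p).1 + (φ p).2) :=
    hs.1.mul ((smoothNear_fst.add smoothNear_snd).comp hφ h0)
  have hd : ∀ v, fderiv ℝ (fun p => s p * ((φ p).1 + (φ p).2)) 0 v =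
      s 0 * ((fderiv ℝ φ 0 v).1 + (fderiv ℝ φ 0 v).2) := by
    intro v
    have d1 := hs.1.eventually_differentiableAt.self_of_nhds.hasFDerivAt
    have d2 := hφ.eventually_differentiableAt.self_of_nhds.hasFDerivAt
    have d3 := (hasFDerivAt_fst (𝕜 := ℝ) (p := φ 0)).comp (0 : Plane) d2
    have d4 := (hasFDerivAt_snd (𝕜 := ℝ) (p := φ 0)).comp (0 : Plane) d2
    refine (congrArg (fun L : Plane →L[ℝ] ℝ => L v) (d1.mul (d3.add d4)).fderiv).trans ?_
    simp [h0, mul_add]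
  refine ⟨_, hsm, hY, codim_eq_one hsm (by simp [h0]) ?_ ?_⟩
  · rw [hd, hx2, add_zero]
    exact mul_ne_zero hs.2 hx1
  · rw [hd, hy1, zero_add]
    exact mul_ne_zero hs.2 hy2

end Classification

theorem mainTheorem5 :
    -- nonvanishing case: conjugate to the Liouville field, whose class has codimension 0
    ((∀ f : Plane → ℝ, SmoothNear f → f 0 ≠ 0 →
        OrbitallyConj liouvilleForm (fun p => f p • liouvilleField p) liouvilleField) ∧
      (∀ Y : Plane → Plane, SmoothNear Y → OrbitallyConj liouvilleForm Y liouvilleField →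
        HasCodim liouvilleField smoothNear_liouvilleField Y 0)) ∧
    -- regular curve transversal to both axes: conjugate to `(x + y) X`, the only class of
    -- codimension 1
    ((∀ f : Plane → ℝ, SmoothNear f → IsRegularCurve f →
        TransversalTo f (1, 0) → TransversalTo f (0, 1) →
        OrbitallyConj liouvilleForm (fun p => f p • liouvilleField p)
          (fun p => (p.1 + p.2) • liouvilleField p)) ∧
      (∀ Y : Plane → Plane, SmoothNear Y →
        (HasCodim liouvilleField smoothNear_liouvilleField Y 1 ↔
          OrbitallyConj liouvilleForm Y (fun p => (p.1 + p.2) • liouvilleField p)))) ∧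
    -- finite codimension `k`: conjugate to the field given by the `k`-jet
    (∀ (f : Plane → ℝ) (hf : SmoothNear f) (k : ℕ), f 0 = 0 →
      codim liouvilleField smoothNear_liouvilleField f hf = (k : Cardinal) →
      OrbitallyConj liouvilleForm (fun p => f p • liouvilleField p)
        (fun p => jet k f p • liouvilleField p)) := by
  refine ⟨⟨fun f hf h0 => orbitallyConj_of_ne_zero hf h0,
    fun Y _ h => hasCodim_zero_of_orbitallyConj h⟩, ⟨fun f hf hreg hx hy => ?_, fun Y _ =>
      ⟨?_, hasCodim_one_of_orbitallyConj⟩⟩,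
    fun f hf k _ hk => (axisEquiv_jet hf hk).orbitallyConj⟩
  · exact orbitallyConj_add_of_codim_eq_one hf (codim_eq_one hf hreg.1
      (fderiv_apply_ne_zero_of_transversalTo hreg.2 hx)
      (fderiv_apply_ne_zero_of_transversalTo hreg.2 hy))
  · rintro ⟨g, hg, hY, hcodim⟩
    exact (orbitallyConj_add_of_codim_eq_one hg hcodim).congr_left hY.symm
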